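/- Throughout, graphs are finite and simple, and $[n]=\{1,\dots,n\}$. **Equations.** A (translation-invariant) equation $E$ is a formal equation $a_1x_1+\dots+a_kx_k=0$ with non-zero integer coefficients satisfying $a_1+\dots+a_k=0$. It is *convex* if all but one of its coefficients have the same sign (that is, exactly one coefficient is negative, up to multiplying the equation by $-1$). Its *genus* is the largest integer $m$ for which the index set $[k]$ can be partitioned into $m$ non-empty sets $\mathcal T_1,\dots,\mathcal T_m$ with $\sum_{i\in\mathcal T_j}a_i=0$ for every $j$. **Coloured graphs.** Let $F$ be a graph. An $F$-coloured graph $(H,\sigma)$ is a graph $H$ with a homomorphism $\sigma\colon H\to F$; it is an $F$-coloured cycle if $H$ is a cycle (of length at least $3$). For an injection $c\colon V(F)\to[n]$ and a cycle $v_1v_2\dots v_\ell$ of $H$, the cycle-equation is $$\sum_{i=1}^{\ell}\bigl(c(\sigma(v_{i+1}))-c(\sigma(v_i))\bigr)\,x_{v_iv_{i+1}}=0\qquad(v_{\ell+1}=v_1).$$ $\mathrm{Eq}(H,\sigma,c)$ denotes the system of all cycle-equations of cycles of $H$; if $H$ is a cycle this is a single equation (up to the names of the variables and a global sign). $\mathrm{Eqs}(H,\sigma)$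 is the collection of all the $\mathrm{Eq}(H,\sigma,c)$, over all $n$ and all injections $c\colon V(F)\to[n]$. **Abundance.** A graph $G$ is *uniformly $\varepsilon$-far from $F$-free*, with corresponding $F$-partition $(V_i:i\in V(F))$, if the map sending each vertex of $V_i$ to $i$ is a homomorphism $G\to F$ and there is a collection $\mathcal C$ of pairwise edge-disjoint copies of $F$ in $G$ such that in every copy in $\mathcal C$ the vertex corresponding to $i$ lies in $V_i$ for each $i\in V(F)$, and every vertex of $G$ is in at least $\varepsilon|G|$ copies from $\mathcal C$. An $F$-coloured graph $(H,\sigma)$ is *$F$-abundant* if there are $\gamma>0$ and $K\in\mathbb N$, depending only on $F$, $H$ and $\sigma$, such that for every $\varepsilon>0$ and all sufficiently large $n$, every $n$-vertex graph that is uniformly $\varepsilon$-far from $F$-free with corresponding $F$-partition $(V_i:i\in V(F))$ contains at least $\gamma\varepsilon^{K}n^{|H|}$ copies of $(H,\sigma)$, that is, copies of $H$ in which each $v\in V(H)$ is embedded in $V_{\sigma(v)}$. **Theorem.** Let $(C,\sigma)$ be an $F$-coloured cycle. The following are equivalent: 1. $(C,\sigma)$ is $F$-abundant; 2. no equation from $\mathrm{Eqs}(C,\sigma)$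 is convex; 3. every equation from $\mathrm{Eqs}(C,\sigma)$ has genus at least two. -/

import Mathlib

open Finset

/-! ### Translation-invariant equations -/

/-- A translation-invariant equation `a₁ x₁ + ⋯ + aₖ xₖ = 0`: nonzero integer coefficients
whose sum is zero. -/
structure TranslationInvariantEquation where
  numVars : ℕ
  coeff : Fin numVars → ℤ
  coeff_ne_zero : ∀ i, coeff i ≠ 0
  sum_coeff : ∑ i, coeff i = 0

namespace TranslationInvariantEquation

/-- All but one of the coefficients have the same sign: exactly one coefficient is negative, or
(writing the same equation with the opposite sign) exactly one coefficient is positive. -/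
def IsConvex (E : TranslationInvariantEquation) : Prop :=
  (∃ i, E.coeff i < 0 ∧ ∀ j, j ≠ i → 0 < E.coeff j) ∨
    (∃ i, 0 < E.coeff i ∧ ∀ j, j ≠ i → E.coeff j < 0)

/-- The largest `m` such that the index set can be partitioned into `m` nonempty sets over each of
which the coefficients sum to zero. -/
noncomputable def genus (E : TranslationInvariantEquation) : ℕ :=
  sSup {m : ℕ | ∃ P : Finpartition (univ : Finset (Fin E.numVars)),
    #P.parts = m ∧ ∀ T ∈ P.parts, ∑ i ∈ T, E.coeff i = 0}

end TranslationInvariantEquation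

namespace SimpleGraph

variable {V W X : Type*}

/-! ### Cycles and cycle-equations -/

/-- `C` is a cycle: it is isomorphic to the cycle graph on `ℓ` vertices for some `ℓ ≥ 3`. -/
def IsCycleGraph (C : SimpleGraph W) : Prop :=
  ∃ ℓ : ℕ, 3 ≤ ℓ ∧ Nonempty (cycleGraph ℓ ≃g C)

/-- A cycle `v₁ v₂ … v_ℓ` of `H`, `ℓ ≥ 3`: distinct vertices, cyclically consecutive ones being
adjacent (`finRotate ℓ` sends each index to the cyclically next one). -/
structure CycleIn (H : SimpleGraph W) where
  length : ℕ
  three_le_length : 3 ≤ length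
  vert : Fin length → W
  vert_injective : Function.Injective vert
  adj : ∀ i, H.Adj (vert i) (vert (finRotate length i))

/-- The cycle-equation of the cycle `v₁ … v_ℓ` of the `F`-coloured graph `(H, σ)` for the injection
`c : V(F) → [n]`: the coefficient of the variable of the edge `vᵢ vᵢ₊₁` is
`c (σ vᵢ₊₁) - c (σ vᵢ)`. -/
def cycleEquation {F : SimpleGraph V} {H : SimpleGraph W} (σ : H →g F) {n : ℕ}
    (c : V ↪ Set.Icc 1 n) (z : CycleIn H) : TranslationInvariantEquation where
  numVars := z.length
  coeff i := ((c (σ (z.vert (finRotate z.length i))) : ℕ) : ℤ) - ((c (σ (z.vert i)) : ℕ) : ℤ)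
  coeff_ne_zero i h := by
    have h1 : (c (σ (z.vert (finRotate z.length i))) : ℕ) = (c (σ (z.vert i)) : ℕ) := by
      exact_mod_cast sub_eq_zero.mp h
    exact (σ.map_adj (z.adj i)).ne (c.injective (Subtype.ext h1)).symm
  sum_coeff := by
    rw [Finset.sum_sub_distrib, sub_eq_zero]
    exact Equiv.sum_comp (finRotate z.length) fun i => ((c (σ (z.vert i)) : ℕ) : ℤ)

/-- `Eq(H, σ, c)`: the cycle-equations of all the cycles of `H`. If `H` is itself a cycle, all of
them are the same equation, up to the naming of the variables (the start of the enumeration of the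
cycle) and a global sign (its orientation). -/
def cycleEquations {F : SimpleGraph V} {H : SimpleGraph W} (σ : H →g F) {n : ℕ}
    (c : V ↪ Set.Icc 1 n) : Set TranslationInvariantEquation :=
  Set.range (cycleEquation σ c)

/-- `Eqs(H, σ)`: the equations from all the `Eq(H, σ, c)`, where `c` runs over all the injections
`V(F) → [n]`, for all `n`. -/
def allCycleEquations {F : SimpleGraph V} {H : SimpleGraph W} (σ : H →g F) :
    Set TranslationInvariantEquation :=
  ⋃ (n : ℕ) (c : V ↪ Set.Icc 1 n), cycleEquations σ c

/-! ### Abundance -/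

/-- `G` is uniformly `ε`-far from `F`-free with `F`-partition `(V_i)`, where `V_i = τ⁻¹(i)`: there
is a collection of pairwise edge-disjoint copies of `F` in `G`, in each of which the vertex
corresponding to `i` lies in `V_i`, such that every vertex of `G` is in at least `ε |G|` of them. -/
def IsUniformlyFarFromFree (F : SimpleGraph V) (G : SimpleGraph X) (τ : G →g F) (ε : ℝ) : Prop :=
  ∃ 𝒞 : Set (Copy F G),
    (∀ f ∈ 𝒞, ∀ i, τ (f i) = i) ∧
    (𝒞.Pairwise fun f g => Disjoint (Sym2.map f '' F.edgeSet) (Sym2.map g '' F.edgeSet)) ∧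
    ∀ x : X, ε * (Nat.card X : ℝ) ≤ ({f ∈ 𝒞 | x ∈ Set.range f}.ncard : ℝ)

/-- The `F`-coloured graph `(H, σ)` is `F`-abundant: every sufficiently large `n`-vertex graph `G`
that is uniformly `ε`-far from `F`-free, with `F`-partition `τ`, contains at least
`poly(ε) n ^ |H|` copies of `(H, σ)`, i.e. copies of `H` with each `v` embedded in part `σ v`. -/
def IsAbundant (F : SimpleGraph V) (H : SimpleGraph W) (σ : H →g F) : Prop :=
  ∃ γ : ℝ, 0 < γ ∧ ∃ K : ℕ, ∀ ε : ℝ, 0 < ε → ∃ n₀ : ℕ, ∀ n : ℕ, n₀ ≤ n →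
    ∀ (G : SimpleGraph (Fin n)) (τ : G →g F), IsUniformlyFarFromFree F G τ ε →
      γ * ε ^ K * (n : ℝ) ^ Nat.card W ≤ (Nat.card {f : Copy H G // ∀ v, τ (f v) = σ v} : ℝ)

end SimpleGraph

/-!
The three conditions are each equivalent to `σ` not being injective.

For the two conditions on equations this is elementary. If `σ` is injective, `c` can be chosen to
increase along the cycle, and the resulting equation is convex (`exists_isConvex_of_injective`). If
`σ` identifies two vertices of the cycle, the coefficients on either arc between them telescope to
zero, so every equation has genus at least two (`two_le_genus_cycleEquation`), which in turn
excludes convexity (`not_isConvex_of_two_le_genus`).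

*Non-injective implies abundant* (`isAbundant_of_not_injective`). The cycle is mapped to two closed
walks `a` and `b` of `F` based at the same vertex `u`. Let `𝒟` be the given family of edge-disjoint
copies of `F`. For most pairs `f, g ∈ 𝒟` with `f u = g u`, the first vertex of `f` on `a` and the
last vertex of `g` on `b` have many common neighbours `x`, and the last vertex of `f` on `a` and the
first vertex of `g` on `b` have many common neighbours `y`. As there are only about `n ^ 3` such
pairs `(f, g)`, a positive proportion (polynomial in `ε`) of all `(x, y)` occurs for a positive
proportion of the `f ∈ 𝒟` and of the `g ∈ 𝒟` separately (`IsPacking.exists_many_pairs`). Now `f` and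
`g` no longer have to meet: the copies `f` belonging to `(x, y)` form a dense family, along which
there are many walks of type `a` from `x` to `y`, and likewise for `b` from `y` to `x`
(`IsPacking.exists_finset_walks`). Combining these walks gives the required number of maps
(`IsPacking.le_card_hom`), almost all of which are injective.

*Injective implies not abundant* (`not_isAbundant_of_injective`). With `c` increasing by one along
the cycle, copies of the cycle in the Cayley-type graph `differenceGraph` correspond to solutions
of `x₁ + ⋯ + xₘ = m x` in the set of differences. Spheres in `(ℤ / q) ^ d` have only trivial
solutions (`exists_averageFree`) and, for `d` and then `q` large, density more than any prescribed
negative power of `q ^ d`. A further factor `ℤ / b` with `b → ∞` makes the number of vertices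
arbitrarily large at fixed `ε`.
-/

/-! ### Cycles -/

namespace SimpleGraph

variable {V W X : Type*}

/-- A cycle can be traversed once around starting from any of its vertices: `v 0, …, v (ℓ - 1)`
enumerate the vertices, and the edges are the pairs `v k, v (k + 1)`, where `v ℓ = v 0`. -/
theorem IsCycleGraph.exists_enum {C : SimpleGraph W} (hC : C.IsCycleGraph) (w₀ : W) :
    ∃ ℓ : ℕ, 3 ≤ ℓ ∧ ∃ v : ℕ → W, v 0 = w₀ ∧ v ℓ = w₀ ∧ Set.BijOn v (Set.Iio ℓ) Set.univ ∧
      ∀ w w', C.Adj w w' ↔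
        ∃ k < ℓ, (w = v k ∧ w' = v (k + 1)) ∨ (w' = v k ∧ w = v (k + 1)) := by
  obtain ⟨ℓ, hℓ, ⟨e⟩⟩ := hC
  obtain ⟨n, rfl⟩ := Nat.exists_eq_add_of_le' hℓ
  have hsucc : ∀ k, Fin.ofNat (n + 3) (k + 1) = Fin.ofNat (n + 3) k + 1 := by
    intro k
    ext
    simp [Fin.val_add]
  have hval : ∀ i : Fin (n + 3), Fin.ofNat (n + 3) (i : ℕ) = i := by
    intro i
    ext
    simp
  refine ⟨n + 3, hℓ, fun k => e (e.symm w₀ + Fin.ofNat (n + 3) k), ?_, ?_, ⟨?_, ?_, ?_⟩, ?_⟩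
  · have : Fin.ofNat (n + 3) 0 = 0 := rfl
    simp only [this, add_zero, RelIso.apply_symm_apply]
  · have : Fin.ofNat (n + 3) (n + 3) = 0 := by ext; simp
    simp only [this, add_zero, RelIso.apply_symm_apply]
  · exact fun _ _ => Set.mem_univ _
  · intro a ha b hb hab
    have h := congrArg Fin.val (add_left_cancel (e.injective hab))
    simpa [Nat.mod_eq_of_lt (Set.mem_Iio.1 ha), Nat.mod_eq_of_lt (Set.mem_Iio.1 hb)] using h
  · intro w _
    refine ⟨((e.symm w - e.symm w₀ : Fin (n + 3)) : ℕ), Fin.is_lt _, ?_⟩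
    simp only [hval, add_sub_cancel, RelIso.apply_symm_apply]
  · intro w w'
    have key : ∀ u u' : W, e.symm u' - e.symm u = 1 ↔ ∃ k < n + 3,
        u = e (e.symm w₀ + Fin.ofNat (n + 3) k) ∧
          u' = e (e.symm w₀ + Fin.ofNat (n + 3) (k + 1)) := by
      intro u u'
      constructor
      · intro h
        refine ⟨((e.symm u - e.symm w₀ : Fin (n + 3)) : ℕ), Fin.is_lt _, ?_, ?_⟩
        · simp only [hval, add_sub_cancel, RelIso.apply_symm_apply]
        · rw [hsucc, hval, ← h]
          have : e.symm w₀ + (e.symm u - e.symm w₀ + (e.symm u' - e.symm u)) = e.symm u' := by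
            abel
          rw [this, RelIso.apply_symm_apply]
      · rintro ⟨k, -, rfl, rfl⟩
        simp only [RelIso.symm_apply_apply, hsucc]
        abel
    have h1 : C.Adj w w' ↔ e.symm w' - e.symm w = 1 ∨ e.symm w - e.symm w' = 1 := by
      rw [← e.symm.map_adj_iff, cycleGraph_adj, or_comm]
    rw [h1, key, key]
    constructor
    · rintro (⟨k, hk, h⟩ | ⟨k, hk, h⟩)
      exacts [⟨k, hk, Or.inl h⟩, ⟨k, hk, Or.inr h⟩]
    · rintro ⟨k, hk, h | h⟩
      exacts [Or.inl ⟨k, hk, h⟩, Or.inr ⟨k, hk, h⟩]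

theorem IsCycleGraph.exists_neighbors {C : SimpleGraph W} (hC : C.IsCycleGraph) (w : W) :
    ∃ a b, ∀ w', C.Adj w w' → w' = a ∨ w' = b := by
  obtain ⟨ℓ, hℓ, v, h0, -, hv, hadj⟩ := hC.exists_enum w
  refine ⟨v 1, v (ℓ - 1), fun w' h => ?_⟩
  obtain ⟨k, hk, ⟨h1, h2⟩ | ⟨h1, h2⟩⟩ := (hadj _ _).1 h
  · have : 0 = k := hv.injOn (Set.mem_Iio.2 (by omega)) hk (h0.trans h1)
    subst this
    exact Or.inl h2
  · by_cases hk' : k + 1 < ℓ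
    · have : 0 = k + 1 := hv.injOn (Set.mem_Iio.2 (by omega)) hk' (h0.trans h2)
      omega
    · have : k = ℓ - 1 := by omega
      subst this
      exact Or.inr h1

/-- A cycle has no proper cycles: every cycle in a cycle graph passes through all its vertices. -/
theorem IsCycleGraph.surjective_vert {C : SimpleGraph W} (hC : C.IsCycleGraph) (z : CycleIn C) :
    Function.Surjective z.vert := by
  obtain ⟨L, hL, vert, hinj, hadj⟩ := z
  obtain ⟨n, rfl⟩ := Nat.exists_eq_add_of_le' hL
  change Function.Surjective vert
  -- The two cyclic neighbours of a vertex on the cycle already exhaust its neighbours.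
  have hclosed : ∀ i w, C.Adj (vert i) w → w ∈ Set.range vert := by
    intro i w hw
    obtain ⟨a, b, hab⟩ := hC.exists_neighbors (vert i)
    have h1 := hab _ (hadj i)
    have h2 := hab _ (by
      have h := (hadj ((finRotate _).symm i)).symm
      rwa [Equiv.apply_symm_apply] at h)
    have hne : finRotate (n + 3) i ≠ (finRotate (n + 3)).symm i := by
      intro h
      rw [Equiv.eq_symm_apply, finRotate_apply, finRotate_apply, add_assoc] at h
      have h' := congrArg Fin.val (add_eq_left.1 h)
      simp only [Fin.val_add, Fin.val_one, Fin.val_zero, Nat.reduceAdd] at h'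
      rw [Nat.mod_eq_of_lt (by omega)] at h'
      omega
    have hne' := hinj.ne hne
    rcases h1 with h1 | h1 <;> rcases h2 with h2 | h2
    · exact absurd (h1.trans h2.symm) hne'
    · rcases hab w hw with h | h
      exacts [⟨_, h1.trans h.symm⟩, ⟨_, h2.trans h.symm⟩]
    · rcases hab w hw with h | h
      exacts [⟨_, h2.trans h.symm⟩, ⟨_, h1.trans h.symm⟩]
    · exact absurd (h1.trans h2.symm) hne'
  obtain ⟨ℓ, hℓ, v, h0, -, hv, hadj'⟩ := hC.exists_enum (vert 0)
  have hmem : ∀ k ≤ ℓ, v k ∈ Set.range vert := by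
    intro k
    induction k with
    | zero => exact fun _ => ⟨0, h0.symm⟩
    | succ k ih =>
      intro hk
      obtain ⟨i, hi⟩ := ih (by omega)
      exact hclosed i _ ((hadj' _ _).2 ⟨k, hk, Or.inl ⟨hi, rfl⟩⟩)
  intro w
  obtain ⟨k, hk, rfl⟩ := hv.surjOn (Set.mem_univ w)
  exact hmem k (le_of_lt hk)

end SimpleGraph

/-! ### Convexity and genus -/

namespace TranslationInvariantEquation

/-- A zero-sum proper part of a convex equation would have to contain the exceptional index, and so
would its complement. -/
theorem not_isConvex_of_two_le_genus {E : TranslationInvariantEquation} (h : 2 ≤ E.genus) :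
    ¬ E.IsConvex := by
  intro hE
  have hne : ({m : ℕ | ∃ P : Finpartition (univ : Finset (Fin E.numVars)),
      #P.parts = m ∧ ∀ T ∈ P.parts, ∑ i ∈ T, E.coeff i = 0}).Nonempty := by
    by_contra hne
    rw [Set.not_nonempty_iff_eq_empty] at hne
    rw [genus, hne] at h
    simp at h
  have hbdd : BddAbove {m : ℕ | ∃ P : Finpartition (univ : Finset (Fin E.numVars)),
      #P.parts = m ∧ ∀ T ∈ P.parts, ∑ i ∈ T, E.coeff i = 0} := by
    refine ⟨E.numVars, ?_⟩
    rintro m ⟨P, rfl, -⟩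
    simpa using P.card_parts_le_card
  obtain ⟨P, hP, hsum⟩ := Nat.sSup_mem hne hbdd
  change #P.parts = E.genus at hP
  have key : ∀ i, ∃ T ∈ P.parts, i ∉ T := by
    intro i
    obtain ⟨S, hS, T, hT, hST⟩ := Finset.one_lt_card.1 (show 1 < #P.parts by omega)
    by_cases hi : i ∈ S
    · exact ⟨T, hT, fun hi' => hST (P.eq_of_mem_parts hS hT hi hi')⟩
    · exact ⟨S, hS, hi⟩
  rcases hE with ⟨i, -, hi⟩ | ⟨i, -, hi⟩
  · obtain ⟨T, hT, hiT⟩ := key i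
    exact (Finset.sum_pos (fun j hj => hi j (fun h => hiT (h ▸ hj)))
      (P.nonempty_of_mem_parts hT)).ne' (hsum T hT)
  · obtain ⟨T, hT, hiT⟩ := key i
    exact (Finset.sum_neg (fun j hj => hi j (fun h => hiT (h ▸ hj)))
      (P.nonempty_of_mem_parts hT)).ne (hsum T hT)

theorem two_le_genus_of_sum_eq_zero {E : TranslationInvariantEquation}
    (T : Finset (Fin E.numVars)) (hT : T.Nonempty) (hT' : Tᶜ.Nonempty)
    (h : ∑ i ∈ T, E.coeff i = 0) : 2 ≤ E.genus := by
  have hne : T ≠ Tᶜ := by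
    intro h
    obtain ⟨i, hi⟩ := hT
    exact (Finset.mem_compl.1 (h ▸ hi)) hi
  have hcompl : ∑ i ∈ Tᶜ, E.coeff i = 0 := by
    have := Finset.sum_add_sum_compl T E.coeff
    rw [E.sum_coeff] at this
    omega
  refine le_csSup ⟨E.numVars, ?_⟩ ⟨⟨{T, Tᶜ}, ?_, ?_, ?_⟩, ?_, ?_⟩
  · rintro m ⟨P, rfl, -⟩
    simpa using P.card_parts_le_card
  · rw [Finset.supIndep_pair hne]
    exact disjoint_compl_right
  · simp
  · simp only [mem_insert, mem_singleton, not_or]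
    exact ⟨hT.ne_empty.symm, hT'.ne_empty.symm⟩
  · exact Finset.card_pair hne
  · intro S hS
    simp only [mem_insert, mem_singleton] at hS
    rcases hS with rfl | rfl
    exacts [h, hcompl]

end TranslationInvariantEquation

namespace SimpleGraph

variable {V W X : Type*}

/-- If `σ` takes the same value at two vertices of the cycle, the coefficients along either of the
two arcs between them telescope to zero. -/
theorem two_le_genus_cycleEquation {F : SimpleGraph V} {C : SimpleGraph W} (hC : C.IsCycleGraph)
    {σ : C →g F} (hσ : ¬ Function.Injective σ) {n : ℕ} (c : V ↪ Set.Icc 1 n) (z : CycleIn C) :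
    2 ≤ (cycleEquation σ c z).genus := by
  have hsurj := hC.surjective_vert z
  obtain ⟨L, hL, vert, hinj, hadj⟩ := z
  obtain ⟨m, rfl⟩ := Nat.exists_eq_add_of_le' hL
  change Function.Surjective vert at hsurj
  obtain ⟨i, j, hij, hlt⟩ : ∃ i j, σ (vert i) = σ (vert j) ∧ i < j := by
    simp only [Function.Injective, not_forall] at hσ
    obtain ⟨a, b, hab, hne⟩ := hσ
    obtain ⟨i, rfl⟩ := hsurj a
    obtain ⟨j, rfl⟩ := hsurj b
    rcases lt_trichotomy i j with h | h | h
    exacts [⟨i, j, hab, h⟩, absurd (congrArg vert h) hne, ⟨j, i, hab.symm, h⟩]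
  refine TranslationInvariantEquation.two_le_genus_of_sum_eq_zero
    (E := cycleEquation σ c ⟨m + 3, hL, vert, hinj, hadj⟩) (Finset.Ico i j)
    ⟨i, Finset.mem_Ico.2 ⟨le_rfl, hlt⟩⟩
    ⟨j, Finset.mem_compl.2 fun h => absurd (Finset.mem_Ico.1 h).2 (lt_irrefl j)⟩ ?_
  let g : ℕ → ℤ := fun k => ((c (σ (vert (Fin.ofNat (m + 3) k))) : ℕ) : ℤ)
  have hval : ∀ k : Fin (m + 3), Fin.ofNat (m + 3) (k : ℕ) = k := by
    intro k
    ext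
    simp
  have hstep : ∀ k ∈ Finset.Ico i j,
      (cycleEquation σ c ⟨m + 3, hL, vert, hinj, hadj⟩).coeff k = g (k + 1) - g k := by
    intro k hk
    have hk' : k ≠ Fin.last _ := fun h => by
      have := (Finset.mem_Ico.1 hk).2
      exact absurd (Fin.le_last j) (not_le.2 (h ▸ this))
    have h2 : Fin.ofNat (m + 3) ((k : ℕ) + 1) = finRotate (m + 3) k := by
      rw [← coe_finRotate_of_ne_last hk', hval]
    simp only [cycleEquation, g, hval, h2]
  have hmap : (Finset.Ico i j).map Fin.valEmbedding = Finset.Ico (i : ℕ) j :=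
    Fin.map_valEmbedding_Ico i j
  calc _ = ∑ k ∈ Finset.Ico i j, (g (k + 1) - g k) := Finset.sum_congr rfl hstep
    _ = ∑ k ∈ Finset.Ico (i : ℕ) j, (g (k + 1) - g k) := by
      rw [← hmap, Finset.sum_map]; rfl
    _ = g j - g i := Finset.sum_Ico_sub g (le_of_lt hlt)
    _ = 0 := by simp only [g, hval, hij, sub_self]

/-- A numbering of the vertices of `F` which begins with a prescribed sequence of vertices. -/
theorem exists_numbering [Fintype V] {ℓ : ℕ} {u : Fin ℓ → V} (hu : Function.Injective u) :
    ∃ num : V → ℕ, Function.Injective num ∧ (∀ i, num (u i) = i) ∧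
      ∀ v, num v < ℓ + Fintype.card V := by
  classical
  let q : V ≃ Fin (Fintype.card V) := Fintype.equivFin V
  let num : V → ℕ := fun v => if h : ∃ i, u i = v then (h.choose : Fin ℓ) else ℓ + q v
  have hnum : ∀ i, num (u i) = i := by
    intro i
    have h : ∃ j, u j = u i := ⟨i, rfl⟩
    simp only [num, dif_pos h, hu h.choose_spec]
  have hout : ∀ v, (¬ ∃ i, u i = v) → num v = ℓ + q v := fun v h => dif_neg h
  refine ⟨num, ?_, hnum, ?_⟩
  · intro a b hab
    by_cases ha : ∃ i, u i = a <;> by_cases hb : ∃ i, u i = b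
    · obtain ⟨i, rfl⟩ := ha
      obtain ⟨j, rfl⟩ := hb
      rw [hnum, hnum] at hab
      rw [Fin.ext hab]
    · obtain ⟨i, rfl⟩ := ha
      rw [hnum, hout b hb] at hab
      omega
    · obtain ⟨i, rfl⟩ := hb
      rw [hnum, hout a ha] at hab
      omega
    · rw [hout a ha, hout b hb] at hab
      exact q.injective (Fin.ext (by omega))
  · intro v
    by_cases hv : ∃ i, u i = v
    · obtain ⟨i, rfl⟩ := hv
      rw [hnum]
      omega
    · rw [hout v hv]
      omega

/-- If `σ` is injective, the vertices of `F` can be numbered so that the numbers increase along the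
cycle; then only the edge closing the cycle has a negative coefficient. -/
theorem exists_isConvex_of_injective [Finite V] {F : SimpleGraph V} {C : SimpleGraph W}
    (hC : C.IsCycleGraph) {σ : C →g F} (hσ : Function.Injective σ) :
    ∃ E ∈ allCycleEquations σ, E.IsConvex := by
  obtain ⟨ℓ, hℓ, ⟨e⟩⟩ := hC
  obtain ⟨m, rfl⟩ := Nat.exists_eq_add_of_le' hℓ
  have := Fintype.ofFinite V
  obtain ⟨num, hinj, hnum, hlt⟩ := exists_numbering (hσ.comp e.injective)
  let c : V ↪ Set.Icc 1 (m + 3 + Fintype.card V) :=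
    ⟨fun v => ⟨num v + 1, by omega, hlt v⟩,
      fun a b h => hinj (Nat.succ_injective (congrArg Subtype.val h))⟩
  have hadj : ∀ i, C.Adj (e i) (e (finRotate (m + 3) i)) := by
    intro i
    rw [e.map_adj_iff, cycleGraph_adj, finRotate_apply]
    right
    abel
  refine ⟨cycleEquation σ c ⟨m + 3, hℓ, e, e.injective, hadj⟩, ?_, ?_⟩
  · simp only [allCycleEquations, Set.mem_iUnion]
    exact ⟨_, c, _, rfl⟩
  · have hcoeff : ∀ i : Fin (m + 3),
        (cycleEquation σ c ⟨m + 3, hℓ, e, e.injective, hadj⟩).coeff i =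
          ((finRotate (m + 3) i : ℕ) : ℤ) - (i : ℕ) := by
      intro i
      change ((num ((σ ∘ e) (finRotate (m + 3) i)) + 1 : ℕ) : ℤ) - (num ((σ ∘ e) i) + 1 : ℕ) = _
      rw [hnum, hnum]
      push_cast
      ring
    refine Or.inl ⟨Fin.last (m + 2), ?_, ?_⟩
    · rw [hcoeff, finRotate_last]
      simp
      omega
    · intro j hj
      change Fin (m + 3) at j
      rw [hcoeff, coe_finRotate_of_ne_last hj]
      simp

end SimpleGraph

/-! ### Edge-disjoint copies -/

namespace SimpleGraph

variable {V W X : Type*}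

/-- A finite family of pairwise edge-disjoint copies of `F` in `G`, given as maps `V → X`, each of
which is a section of the partition `τ`. Two members which agree on an edge are equal. -/
structure IsPacking (F : SimpleGraph V) (G : SimpleGraph X) (τ : X → V) (𝒟 : Finset (V → X)) :
    Prop where
  apply_eq : ∀ f ∈ 𝒟, ∀ i, τ (f i) = i
  adj : ∀ f ∈ 𝒟, ∀ i j, F.Adj i j → G.Adj (f i) (f j)
  eq_of_adj : ∀ f ∈ 𝒟, ∀ g ∈ 𝒟, ∀ i j, F.Adj i j → f i = g i → f j = g j → f = g

namespace IsPacking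

variable {F : SimpleGraph V} {G : SimpleGraph X} {τ : X → V} {𝒟 : Finset (V → X)}

theorem mono (h : IsPacking F G τ 𝒟) {ℰ : Finset (V → X)} (hℰ : ℰ ⊆ 𝒟) : IsPacking F G τ ℰ :=
  ⟨fun f hf => h.apply_eq f (hℰ hf), fun f hf => h.adj f (hℰ hf),
    fun f hf g hg => h.eq_of_adj f (hℰ hf) g (hℰ hg)⟩

open scoped Classical in
/-- A dense packing contains a nonempty packing all of whose vertices have large degree: a
subpacking maximizing the number of copies minus `θ` times the number of vertices covered has this
property, since deleting a vertex of degree less than `θ` would increase this quantity. -/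
theorem exists_minDegree [Fintype X] (h : IsPacking F G τ 𝒟) {θ : ℝ} (hθ : 0 ≤ θ)
    (hcard : θ * Fintype.card X < #𝒟) :
    ∃ ℰ ⊆ 𝒟, ℰ.Nonempty ∧ ∀ f ∈ ℰ, ∀ i, θ ≤ #{g ∈ ℰ | g i = f i} := by
  let cov : Finset (V → X) → Finset X := fun ℰ => {x | ∃ f ∈ ℰ, ∃ i, f i = x}
  obtain ⟨ℰ, hℰ, hmax⟩ := Finset.exists_max_image 𝒟.powerset
    (fun ℰ => (#ℰ : ℝ) - θ * #(cov ℰ)) ⟨𝒟, by simp⟩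
  rw [Finset.mem_powerset] at hℰ
  refine ⟨ℰ, hℰ, ?_, ?_⟩
  · by_contra hne
    rw [Finset.not_nonempty_iff_eq_empty] at hne
    subst hne
    have h1 := hmax 𝒟 (by simp)
    have h2 : cov ∅ = ∅ := by simp [cov]
    have h3 : (#(cov 𝒟) : ℝ) ≤ Fintype.card X := by exact_mod_cast Finset.card_le_univ _
    have h4 := mul_le_mul_of_nonneg_left h3 hθ
    simp only [h2, Finset.card_empty] at h1
    push_cast at h1
    linarith
  · intro f hf i
    by_contra hlt
    rw [not_le] at hlt
    have h1 := hmax {g ∈ ℰ | ¬ g i = f i}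
      (Finset.mem_powerset.2 ((Finset.filter_subset _ _).trans hℰ))
    have h2 : #{g ∈ ℰ | g i = f i} + #{g ∈ ℰ | ¬ g i = f i} = #ℰ :=
      Finset.card_filter_add_card_filter_not _
    have h3 : cov {g ∈ ℰ | ¬ g i = f i} ⊂ cov ℰ := by
      rw [Finset.ssubset_iff_of_subset]
      · refine ⟨f i, by simpa [cov] using ⟨f, hf, i, rfl⟩, ?_⟩
        simp only [cov, Finset.mem_filter, Finset.mem_univ, true_and, not_exists, not_and]
        intro g hg j hj
        have : j = i := by
          rw [← h.apply_eq g (hℰ hg.1) j, hj, h.apply_eq f (hℰ hf) i]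
        subst this
        exact hg.2 hj
      · intro x
        simp only [cov, Finset.mem_filter, Finset.mem_univ, true_and]
        rintro ⟨g, hg, j, hj⟩
        exact ⟨g, hg.1, j, hj⟩
    have h4 : #(cov {g ∈ ℰ | ¬ g i = f i}) + 1 ≤ #(cov ℰ) := Finset.card_lt_card h3
    have h5 : (#(cov {g ∈ ℰ | ¬ g i = f i}) : ℝ) + 1 ≤ #(cov ℰ) := by exact_mod_cast h4
    have h6 : (#{g ∈ ℰ | g i = f i} : ℝ) + #{g ∈ ℰ | ¬ g i = f i} = #ℰ := by exact_mod_cast h2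
    nlinarith

end IsPacking

open scoped Classical in
theorem IsUniformlyFarFromFree.exists_isPacking [Finite V] [Fintype X] {F : SimpleGraph V}
    {G : SimpleGraph X} {τ : G →g F} {ε : ℝ} (h : IsUniformlyFarFromFree F G τ ε) :
    ∃ 𝒟 : Finset (V → X), IsPacking F G τ 𝒟 ∧
      ∀ x, ε * Fintype.card X ≤ #{f ∈ 𝒟 | f (τ x) = x} := by
  obtain ⟨𝒞, h1, h2, h3⟩ := h
  have := Fintype.ofFinite V
  refine ⟨({f | ∃ g ∈ 𝒞, ⇑g = f} : Finset (V → X)), ⟨?_, ?_, ?_⟩, ?_⟩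
  · simp only [Finset.mem_filter, Finset.mem_univ, true_and]
    rintro _ ⟨f, hf, rfl⟩
    exact h1 f hf
  · simp only [Finset.mem_filter, Finset.mem_univ, true_and]
    rintro _ ⟨f, hf, rfl⟩ i j hij
    exact f.toHom.map_adj hij
  · simp only [Finset.mem_filter, Finset.mem_univ, true_and]
    rintro _ ⟨f, hf, rfl⟩ _ ⟨g, hg, rfl⟩ i j hij hi hj
    by_contra hne
    have hne' : f ≠ g := fun h => hne (by rw [h])
    refine Set.disjoint_left.1 (h2 hf hg hne')
      (show Sym2.map f s(i, j) ∈ Sym2.map f '' F.edgeSet from ⟨s(i, j), hij, rfl⟩)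
      ⟨s(i, j), hij, ?_⟩
    simp [hi, hj]
  · intro x
    rw [← Nat.card_eq_fintype_card]
    refine (h3 x).trans ?_
    norm_cast
    rw [← Set.ncard_coe_finset]
    refine Set.ncard_le_ncard_of_injOn (fun f => (f : V → X)) ?_
      (DFunLike.coe_injective.injOn) (Set.toFinite _)
    rintro f ⟨hf, i, rfl⟩
    simp only [Finset.coe_filter, Finset.mem_filter, Finset.mem_univ, true_and, Set.mem_ofPred_eq]
    exact ⟨⟨f, hf, rfl⟩, by rw [h1 f hf]⟩

/-! ### Counting walks -/

open scoped Classical in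
/-- Greedy count of walks `Z 0, …, Z m` through prescribed layers. Past its end a walk takes the
constant value `y`, so that equal walks are equal functions. -/
theorem exists_finset_walks (R : X → X → Prop) (T : ℕ → Finset X) (y : X) {θ : ℝ} (hθ : 0 ≤ θ)
    (h0 : (T 0).Nonempty) (m : ℕ)
    (h : ∀ k < m, ∀ z ∈ T k, θ ≤ #{r ∈ T (k + 1) | R z r}) :
    ∃ S : Finset (ℕ → X), θ ^ m ≤ #S ∧ ∀ Z ∈ S,
      (∀ k ≤ m, Z k ∈ T k) ∧ (∀ k, m < k → Z k = y) ∧ ∀ k < m, R (Z k) (Z (k + 1)) := by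
  induction m with
  | zero =>
    obtain ⟨x, hx⟩ := h0
    refine ⟨{Function.update (fun _ => y) 0 x}, by simp, ?_⟩
    simp only [Finset.mem_singleton, forall_eq]
    refine ⟨?_, ?_, by simp⟩
    · intro k hk
      obtain rfl : k = 0 := by omega
      simpa using hx
    · intro k hk
      rw [Function.update_of_ne (by omega)]
  | succ m ih =>
    obtain ⟨S, hS, hprop⟩ := ih fun k hk => h k (by omega)
    refine ⟨(S.sigma fun Z => {r ∈ T (m + 1) | R (Z m) r}).image
      fun p => Function.update p.1 (m + 1) p.2, ?_, ?_⟩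
    · rw [Finset.card_image_of_injOn, Finset.card_sigma]
      · push_cast
        calc θ ^ (m + 1) = θ ^ m * θ := pow_succ _ _
          _ ≤ #S * θ := by gcongr
          _ = ∑ _Z ∈ S, θ := by simp
          _ ≤ _ := Finset.sum_le_sum fun Z hZ =>
            h m (by omega) _ ((hprop Z hZ).1 m le_rfl)
      · rintro ⟨Z, r⟩ hZ ⟨Z', r'⟩ hZ' heq
        simp only [Finset.coe_sigma, Set.mem_sigma_iff, Finset.mem_coe] at hZ hZ'
        have hr : r = r' := by simpa using congrFun heq (m + 1)
        have hZZ : Z = Z' := by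
          funext k
          by_cases hk : k = m + 1
          · subst hk
            rw [(hprop Z hZ.1).2.1 _ (by omega), (hprop Z' hZ'.1).2.1 _ (by omega)]
          · simpa [hk] using congrFun heq k
        subst hr hZZ
        rfl
    · intro Z' hZ'
      simp only [Finset.mem_image, Finset.mem_sigma, Finset.mem_filter] at hZ'
      obtain ⟨⟨Z, r⟩, ⟨hZ, hr, hR⟩, rfl⟩ := hZ'
      obtain ⟨p1, p2, p3⟩ := hprop Z hZ
      refine ⟨?_, ?_, ?_⟩
      · intro k hk
        by_cases hk' : k = m + 1
        · subst hk'
          simpa using hr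
        · simpa [hk'] using p1 k (by omega)
      · intro k hk
        rw [Function.update_of_ne (by omega)]
        exact p2 k (by omega)
      · intro k hk
        rw [Function.update_of_ne (by omega)]
        by_cases hk' : k = m
        · subst hk'
          simpa using hR
        · rw [Function.update_of_ne (by omega)]
          exact p3 k (by omega)

open scoped Classical in
/-- If many copies of a packing have their vertex of type `a 1` adjacent to `x` and their vertex of
type `a (s + 1)` adjacent to `y`, then there are many walks of type `a` from `x` to `y`: after
passing to a subpacking of large minimum degree, any walk along it can be closed up. -/
theorem IsPacking.exists_finset_walks [Fintype X] {F : SimpleGraph V} {G : SimpleGraph X}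
    {τ : X → V} {𝒟 : Finset (V → X)} (h : IsPacking F G τ 𝒟) {θ : ℝ} (hθ : 0 ≤ θ) {s : ℕ}
    {a : ℕ → V} (ha : ∀ k < s + 2, F.Adj (a k) (a (k + 1))) {x y : X} (hx : τ x = a 0)
    (hy : τ y = a (s + 2))
    (hcard : θ * Fintype.card X < #{f ∈ 𝒟 | G.Adj x (f (a 1)) ∧ G.Adj (f (a (s + 1))) y}) :
    ∃ S : Finset (ℕ → X), θ ^ (s + 1) ≤ #S ∧ ∀ Z ∈ S,
      Z 0 = x ∧ (∀ k, s + 2 ≤ k → Z k = y) ∧ (∀ k ≤ s + 2, τ (Z k) = a k) ∧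
        ∀ k < s + 2, G.Adj (Z k) (Z (k + 1)) := by
  obtain ⟨ℰ, hℰ, ⟨f₀, hf₀⟩, hdeg⟩ := (h.mono (Finset.filter_subset _ _)).exists_minDegree hθ hcard
  have hℰ𝒟 : IsPacking F G τ ℰ := h.mono (hℰ.trans (Finset.filter_subset _ _))
  have hend : ∀ f ∈ ℰ, G.Adj x (f (a 1)) ∧ G.Adj (f (a (s + 1))) y := fun f hf =>
    (Finset.mem_filter.1 (hℰ hf)).2
  let T : ℕ → Finset X := fun k => if k = 0 then {x} else ℰ.image fun f => f (a k)
  have hT : ∀ k, T (k + 1) = ℰ.image fun f => f (a (k + 1)) := fun k => if_neg (by omega)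
  have hT0 : T 0 = {x} := if_pos rfl
  have hstep : ∀ f ∈ ℰ, ∀ k < s + 2, θ ≤ #({g ∈ ℰ | g (a k) = f (a k)}.image
      fun g => g (a (k + 1))) := by
    intro f hf k hk
    rw [Finset.card_image_of_injOn]
    · exact hdeg f hf (a k)
    · intro g hg g' hg' heq
      simp only [Finset.coe_filter, Set.mem_ofPred_eq] at hg hg'
      exact hℰ𝒟.eq_of_adj g hg.1 g' hg'.1 _ _ (ha k hk) (hg.2.trans hg'.2.symm) heq
  obtain ⟨S, hS, hprop⟩ := SimpleGraph.exists_finset_walks G.Adj T y hθ (by simp [hT0]) (s + 1) (by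
    intro k hk z hz
    rcases k with _ | k
    · rw [hT0, Finset.mem_singleton] at hz
      subst hz
      refine (hstep f₀ hf₀ 0 (by omega)).trans (Nat.cast_le.2 (Finset.card_le_card ?_))
      intro r hr
      simp only [Finset.mem_image, Finset.mem_filter] at hr
      obtain ⟨g, ⟨hg, -⟩, rfl⟩ := hr
      rw [hT, Finset.mem_filter]
      exact ⟨Finset.mem_image_of_mem _ hg, (hend g hg).1⟩
    · rw [hT, Finset.mem_image] at hz
      obtain ⟨f, hf, rfl⟩ := hz
      refine (hstep f hf (k + 1) (by omega)).trans (Nat.cast_le.2 (Finset.card_le_card ?_))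
      intro r hr
      simp only [Finset.mem_image, Finset.mem_filter] at hr
      obtain ⟨g, ⟨hg, hgf⟩, rfl⟩ := hr
      rw [hT, Finset.mem_filter, ← hgf]
      exact ⟨Finset.mem_image_of_mem _ hg, hℰ𝒟.adj g hg _ _ (ha _ (by omega))⟩)
  refine ⟨S, hS, fun Z hZ => ?_⟩
  obtain ⟨p1, p2, p3⟩ := hprop Z hZ
  have hZ0 : Z 0 = x := by simpa [hT0] using p1 0 (by omega)
  have hZy : Z (s + 2) = y := p2 _ (by omega)
  refine ⟨hZ0, fun k hk => p2 k (by omega), ?_, ?_⟩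
  · intro k hk
    rcases k with _ | k
    · rw [hZ0, hx]
    · by_cases hk' : k = s + 1
      · subst hk'
        rw [hZy, hy]
      · have := p1 (k + 1) (by omega)
        rw [hT, Finset.mem_image] at this
        obtain ⟨f, hf, hfk⟩ := this
        rw [← hfk, hℰ𝒟.apply_eq f hf]
  · intro k hk
    by_cases hk' : k = s + 1
    · subst hk'
      have := p1 (s + 1) le_rfl
      rw [hT, Finset.mem_image] at this
      obtain ⟨f, hf, hfk⟩ := this
      rw [hZy, ← hfk]
      exact (hend f hf).2
    · exact p3 k (by omega)

/-! ### Pairs of copies through a common vertex -/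

open scoped Classical in
/-- The part of `i` has at least `ε n` vertices, since the copies through a fixed vertex of type `u`
have different vertices of type `i`; each of these vertices is in at least `ε n` copies. -/
theorem IsPacking.sq_le_card [Fintype X] [Nonempty X] {F : SimpleGraph V} {G : SimpleGraph X}
    {τ : X → V} {𝒟 : Finset (V → X)} (h : IsPacking F G τ 𝒟) {ε : ℝ} (hε : 0 < ε)
    (hdeg : ∀ x, ε * Fintype.card X ≤ #{f ∈ 𝒟 | f (τ x) = x}) {u i : V} (hui : F.Adj u i) :
    (ε * Fintype.card X) ^ 2 ≤ #𝒟 := by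
  have hn : (0 : ℝ) < Fintype.card X := by exact_mod_cast Fintype.card_pos
  obtain ⟨x₀⟩ := ‹Nonempty X›
  have h1 : (0 : ℝ) < #{f ∈ 𝒟 | f (τ x₀) = x₀} := (by positivity : 0 < ε * _).trans_le (hdeg x₀)
  have h2 : 0 < #{f ∈ 𝒟 | f (τ x₀) = x₀} := by exact_mod_cast h1
  obtain ⟨f₀, hf₀⟩ := Finset.card_pos.1 h2
  have hf₀ := (Finset.mem_filter.1 hf₀).1
  have hpart : ε * Fintype.card X ≤ #{x : X | τ x = i} := by
    refine (hdeg (f₀ u)).trans ?_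
    rw [h.apply_eq f₀ hf₀]
    norm_cast
    refine Finset.card_le_card_of_injOn (fun f => f i) ?_ ?_
    · intro f hf
      simp only [Finset.coe_filter, Set.mem_ofPred_eq] at hf
      simp [h.apply_eq f hf.1]
    · intro f hf g hg heq
      simp only [Finset.coe_filter, Set.mem_ofPred_eq] at hf hg
      exact h.eq_of_adj f hf.1 g hg.1 u i hui (hf.2.trans hg.2.symm) heq
  have hfib : #𝒟 = ∑ x ∈ {x : X | τ x = i}, #{f ∈ 𝒟 | f i = x} :=
    Finset.card_eq_sum_card_fiberwise fun f hf => by simp [h.apply_eq f hf]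
  rw [hfib]
  push_cast
  calc (ε * Fintype.card X) ^ 2 = (ε * Fintype.card X) * (ε * Fintype.card X) := sq _
    _ ≤ #{x : X | τ x = i} * (ε * Fintype.card X) := by gcongr
    _ = ∑ x ∈ {x : X | τ x = i}, ε * Fintype.card X := by simp
    _ ≤ _ := Finset.sum_le_sum fun x hx => by
      have := hdeg x
      rwa [(Finset.mem_filter.1 hx).2] at this

open scoped Classical in
/-- Few pairs of copies with a common vertex of type `u` have small codegree at their vertices of
types `i` and `j`: such a pair is determined by these two vertices and a common neighbour. -/
theorem IsPacking.card_codegree_lt_le [Fintype X] {F : SimpleGraph V} {G : SimpleGraph X}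
    {τ : X → V} {𝒟 : Finset (V → X)} (h : IsPacking F G τ 𝒟) {u i j : V} (hi : F.Adj u i)
    (hj : F.Adj u j) {c : ℝ} (hc : 0 ≤ c) :
    (#{p ∈ 𝒟 ×ˢ 𝒟 | p.1 u = p.2 u ∧
      (#{x : X | τ x = u ∧ G.Adj x (p.1 i) ∧ G.Adj x (p.2 j)} : ℝ) < c} : ℝ) ≤
        c * Fintype.card X ^ 2 := by
  rw [Finset.card_eq_sum_card_fiberwise (f := fun p => (p.1 i, p.2 j)) (t := Finset.univ)
    fun _ _ => by simp]
  push_cast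
  calc _ ≤ ∑ _q : X × X, c := Finset.sum_le_sum fun q _ => ?_
    _ = c * Fintype.card X ^ 2 := by simp; ring
  rw [Finset.filter_filter]
  by_cases hq : (#{x : X | τ x = u ∧ G.Adj x q.1 ∧ G.Adj x q.2} : ℝ) < c
  · refine le_trans ?_ hq.le
    norm_cast
    refine Finset.card_le_card_of_injOn (fun p => p.1 u) ?_ ?_
    · rintro ⟨f, g⟩ hp
      simp only [Finset.coe_filter, Finset.mem_product, Set.mem_ofPred_eq, Prod.ext_iff] at hp
      obtain ⟨q₁, q₂⟩ := q
      obtain ⟨⟨hf, hg⟩, ⟨hu, -⟩, rfl, rfl⟩ := hp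
      simp only [Finset.coe_filter, Finset.mem_univ, true_and, Set.mem_ofPred_eq]
      exact ⟨h.apply_eq f hf u, h.adj f hf _ _ hi, hu ▸ h.adj g hg _ _ hj⟩
    · rintro ⟨f, g⟩ hp ⟨f', g'⟩ hp' heq
      simp only [Finset.coe_filter, Finset.mem_product, Set.mem_ofPred_eq,
        Prod.ext_iff] at hp hp' heq
      have e1 := h.eq_of_adj f hp.1.1 f' hp'.1.1 u i hi heq (hp.2.2.1.trans hp'.2.2.1.symm)
      have e2 := h.eq_of_adj g hp.1.2 g' hp'.1.2 u j hj
        (hp.2.1.1.symm.trans (heq.trans hp'.2.1.1)) (hp.2.2.2.trans hp'.2.2.2.symm)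
      rw [e1, e2]
  · rw [Finset.filter_false_of_mem]
    · simpa using hc
    · rintro p - ⟨⟨-, hp⟩, rfl⟩
      exact hq hp

open scoped Classical in
/-- There are many pairs `x, y` in the part of `u` such that many copies `f` satisfy
`x ∼ f i₁`, `f i₂ ∼ y` and, at the same time, many copies `g` satisfy `y ∼ g j₁`, `g j₂ ∼ x`.

Start from the pairs of copies `(f, g)` meeting in the part of `u`. For most of them both
`f i₁, g j₂` and `f i₂, g j₁` have many common neighbours, by `IsPacking.card_codegree_lt_le`.
Choosing `x` and `y` as such common neighbours gives a positive proportion of all possible quadruples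
`(x, y, f, g)`, of which there are only `n ^ 5` because `f` and `g` meet. -/
theorem IsPacking.exists_many_pairs [Fintype X] [Nonempty X] {F : SimpleGraph V}
    {G : SimpleGraph X} {τ : X → V} {𝒟 : Finset (V → X)} (h : IsPacking F G τ 𝒟) {ε : ℝ}
    (hε : 0 < ε) (hdeg : ∀ x, ε * Fintype.card X ≤ #{f ∈ 𝒟 | f (τ x) = x}) {u i₁ i₂ j₁ j₂ : V}
    (hi₁ : F.Adj u i₁) (hi₂ : F.Adj u i₂) (hj₁ : F.Adj u j₁) (hj₂ : F.Adj u j₂) :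
    ∃ L : Finset (X × X), ε ^ 9 / 64 * Fintype.card X ^ 2 ≤ #L ∧ ∀ p ∈ L,
      τ p.1 = u ∧ τ p.2 = u ∧
      ε ^ 9 / 64 * Fintype.card X ^ 2 ≤ #{f ∈ 𝒟 | G.Adj p.1 (f i₁) ∧ G.Adj (f i₂) p.2} ∧
      ε ^ 9 / 64 * Fintype.card X ^ 2 ≤ #{g ∈ 𝒟 | G.Adj p.2 (g j₁) ∧ G.Adj (g j₂) p.1} := by
  have hcard := h.sq_le_card hε hdeg hi₁
  have hn : (0 : ℝ) < Fintype.card X := by exact_mod_cast Fintype.card_pos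
  have huniv : Fintype.card X = #(univ : Finset X) := rfl
  set n : ℝ := (Fintype.card X : ℝ) with hn_def
  let N : V → V → (V → X) × (V → X) → ℝ := fun i j p =>
    #{x : X | τ x = u ∧ G.Adj x (p.1 i) ∧ G.Adj x (p.2 j)}
  let c : ℝ := ε ^ 3 / 4 * n
  have hc : 0 < c := by positivity
  have hbow : ε ^ 3 * n ^ 3 ≤ #{p ∈ 𝒟 ×ˢ 𝒟 | p.1 u = p.2 u} := by
    rw [Finset.card_eq_sum_card_fiberwise (f := Prod.fst) (t := 𝒟)
      fun p hp => (Finset.mem_product.1 (Finset.mem_filter.1 hp).1).1]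
    push_cast
    calc ε ^ 3 * n ^ 3 = (ε * n) ^ 2 * (ε * n) := by ring
      _ ≤ #𝒟 * (ε * n) := by gcongr
      _ = ∑ f ∈ 𝒟, ε * n := by simp
      _ ≤ _ := Finset.sum_le_sum fun f hf => ?_
    refine (hdeg (f u)).trans ?_
    rw [h.apply_eq f hf]
    norm_cast
    refine Finset.card_le_card_of_injOn (fun g => (f, g)) ?_ ?_
    · intro g hg
      simp only [Finset.coe_filter, Set.mem_ofPred_eq] at hg
      simp [hf, hg.1, hg.2]
    · intro g _ g' _ heq
      exact (Prod.ext_iff.1 heq).2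
  let good : Finset ((V → X) × (V → X)) :=
    {p ∈ 𝒟 ×ˢ 𝒟 | p.1 u = p.2 u ∧ c ≤ N i₁ j₂ p ∧ c ≤ N i₂ j₁ p}
  have hgood : ε ^ 3 / 2 * n ^ 3 ≤ #good := by
    have h1 := h.card_codegree_lt_le hi₁ hj₂ hc.le
    have h2 := h.card_codegree_lt_le hi₂ hj₁ hc.le
    have hsub : {p ∈ 𝒟 ×ˢ 𝒟 | p.1 u = p.2 u} ⊆ good ∪
        ({p ∈ 𝒟 ×ˢ 𝒟 | p.1 u = p.2 u ∧ N i₁ j₂ p < c} ∪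
          {p ∈ 𝒟 ×ˢ 𝒟 | p.1 u = p.2 u ∧ N i₂ j₁ p < c}) := by
      intro p hp
      simp only [good, Finset.mem_union, Finset.mem_filter] at hp ⊢
      rcases lt_or_ge (N i₁ j₂ p) c with h3 | h3
      · exact Or.inr (Or.inl ⟨hp.1, hp.2, h3⟩)
      · rcases lt_or_ge (N i₂ j₁ p) c with h4 | h4
        · exact Or.inr (Or.inr ⟨hp.1, hp.2, h4⟩)
        · exact Or.inl ⟨hp.1, hp.2, h3, h4⟩
    have h3 : (#{p ∈ 𝒟 ×ˢ 𝒟 | p.1 u = p.2 u} : ℝ) ≤ #good +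
        (#{p ∈ 𝒟 ×ˢ 𝒟 | p.1 u = p.2 u ∧ N i₁ j₂ p < c} +
          #{p ∈ 𝒟 ×ˢ 𝒟 | p.1 u = p.2 u ∧ N i₂ j₁ p < c}) := by
      exact_mod_cast (Finset.card_le_card hsub).trans ((Finset.card_union_le _ _).trans
        (Nat.add_le_add_left (Finset.card_union_le _ _) _))
    have h4 : c * n ^ 2 = ε ^ 3 / 4 * n ^ 3 := by simp only [c]; ring
    simp only [← hn_def, h4] at h1 h2
    simp only [N] at h3
    linarith
  let r : (V → X) × (V → X) → X × X → Prop := fun p q =>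
    (τ q.1 = u ∧ G.Adj q.1 (p.1 i₁) ∧ G.Adj q.1 (p.2 j₂)) ∧
      τ q.2 = u ∧ G.Adj q.2 (p.1 i₂) ∧ G.Adj q.2 (p.2 j₁)
  have hdouble : ∑ p ∈ good, #{q : X × X | r p q} = ∑ q : X × X, #{p ∈ good | r p q} :=
    Finset.sum_card_bipartiteAbove_eq_sum_card_bipartiteBelow r
  have hlow : ε ^ 9 / 32 * n ^ 5 ≤ ∑ q : X × X, (#{p ∈ good | r p q} : ℝ) := by
    have h1 : ∀ p ∈ good, c ^ 2 ≤ (#{q : X × X | r p q} : ℝ) := by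
      intro p hp
      simp only [good, Finset.mem_filter] at hp
      have : ({q : X × X | r p q} : Finset (X × X)) =
          ({x : X | τ x = u ∧ G.Adj x (p.1 i₁) ∧ G.Adj x (p.2 j₂)} : Finset X) ×ˢ
            ({x : X | τ x = u ∧ G.Adj x (p.1 i₂) ∧ G.Adj x (p.2 j₁)} : Finset X) := by
        ext q
        simp [r]
      rw [this, Finset.card_product, sq]
      push_cast
      exact mul_le_mul hp.2.2.1 hp.2.2.2 hc.le (Nat.cast_nonneg _)
    calc ε ^ 9 / 32 * n ^ 5 = ε ^ 3 / 2 * n ^ 3 * c ^ 2 := by simp only [c]; ring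
      _ ≤ #good * c ^ 2 := by gcongr
      _ = ∑ p ∈ good, c ^ 2 := by simp
      _ ≤ ∑ p ∈ good, (#{q : X × X | r p q} : ℝ) := Finset.sum_le_sum h1
      _ = _ := by exact_mod_cast hdouble
  have hup : ∀ q : X × X, (#{p ∈ good | r p q} : ℝ) ≤ n ^ 3 := by
    intro q
    have : #{p ∈ good | r p q} ≤
        #((univ : Finset X) ×ˢ (univ : Finset X) ×ˢ (univ : Finset X)) := by
      refine Finset.card_le_card_of_injOn (fun p => (p.1 u, p.1 i₁, p.2 j₁)) (by simp) ?_
      rintro ⟨f, g⟩ hp ⟨f', g'⟩ hp' heq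
      simp only [good, Finset.coe_filter, Finset.mem_filter, Finset.mem_product, Set.mem_ofPred_eq,
        Prod.ext_iff] at hp hp' heq
      have e1 := h.eq_of_adj f hp.1.1.1 f' hp'.1.1.1 u i₁ hi₁ heq.1 heq.2.1
      have e2 := h.eq_of_adj g hp.1.1.2 g' hp'.1.1.2 u j₁ hj₁
        (hp.1.2.1.symm.trans (heq.1.trans hp'.1.2.1)) heq.2.2
      rw [e1, e2]
    rw [Finset.card_product, Finset.card_product, ← huniv] at this
    calc (#{p ∈ good | r p q} : ℝ) ≤ n * (n * n) := by
          rw [hn_def]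
          exact_mod_cast this
      _ = n ^ 3 := by ring
  have hleft : ∀ q : X × X, (#{p ∈ good | r p q} : ℝ) ≤
      #{f ∈ 𝒟 | G.Adj q.1 (f i₁) ∧ G.Adj (f i₂) q.2} * n := by
    intro q
    rw [hn_def, huniv]
    norm_cast
    rw [← Finset.card_product]
    refine Finset.card_le_card_of_injOn (fun p => (p.1, p.2 j₁)) ?_ ?_
    · rintro ⟨f, g⟩ hp
      simp only [good, r, Finset.coe_filter, Finset.mem_filter, Finset.mem_product,
        Set.mem_ofPred_eq] at hp
      simp only [Finset.coe_product, Finset.coe_filter, Finset.coe_univ, Set.mem_prod,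
        Set.mem_ofPred_eq, Set.mem_univ, and_true]
      exact ⟨hp.1.1.1, hp.2.1.2.1, hp.2.2.2.1.symm⟩
    · rintro ⟨f, g⟩ hp ⟨f', g'⟩ hp' heq
      simp only [good, Finset.coe_filter, Finset.mem_filter, Finset.mem_product, Set.mem_ofPred_eq,
        Prod.ext_iff] at hp hp' heq
      have e1 : f = f' := heq.1
      have e2 := h.eq_of_adj g hp.1.1.2 g' hp'.1.1.2 u j₁ hj₁
        (hp.1.2.1.symm.trans ((congrFun e1 u).trans hp'.1.2.1)) heq.2
      rw [e1, e2]
  have hright : ∀ q : X × X, (#{p ∈ good | r p q} : ℝ) ≤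
      #{g ∈ 𝒟 | G.Adj q.2 (g j₁) ∧ G.Adj (g j₂) q.1} * n := by
    intro q
    rw [hn_def, huniv]
    norm_cast
    rw [← Finset.card_product]
    refine Finset.card_le_card_of_injOn (fun p => (p.2, p.1 i₁)) ?_ ?_
    · rintro ⟨f, g⟩ hp
      simp only [good, r, Finset.coe_filter, Finset.mem_filter, Finset.mem_product,
        Set.mem_ofPred_eq] at hp
      simp only [Finset.coe_product, Finset.coe_filter, Finset.coe_univ, Set.mem_prod,
        Set.mem_ofPred_eq, Set.mem_univ, and_true]
      exact ⟨hp.1.1.2, hp.2.2.2.2, hp.2.1.2.2.symm⟩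
    · rintro ⟨f, g⟩ hp ⟨f', g'⟩ hp' heq
      simp only [good, Finset.coe_filter, Finset.mem_filter, Finset.mem_product, Set.mem_ofPred_eq,
        Prod.ext_iff] at hp hp' heq
      have e2 : g = g' := heq.1
      have e1 := h.eq_of_adj f hp.1.1.1 f' hp'.1.1.1 u i₁ hi₁
        (hp.1.2.1.trans ((congrFun e2 u).trans hp'.1.2.1.symm)) heq.2
      rw [e1, e2]
  refine ⟨({q | ε ^ 9 / 64 * n ^ 3 ≤ #{p ∈ good | r p q}} : Finset (X × X)), ?_, ?_⟩
  · set L : Finset (X × X) := {q | ε ^ 9 / 64 * n ^ 3 ≤ #{p ∈ good | r p q}} with hL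
    have h1 : ∑ q : X × X, (#{p ∈ good | r p q} : ℝ) ≤
        ∑ q : X × X, ((if q ∈ L then n ^ 3 else 0) + ε ^ 9 / 64 * n ^ 3) := by
      refine Finset.sum_le_sum fun q _ => ?_
      split_ifs with hq
      · have : 0 ≤ ε ^ 9 / 64 * n ^ 3 := by positivity
        linarith [hup q]
      · rw [hL, Finset.mem_filter, not_and, not_le] at hq
        linarith [hq (Finset.mem_univ q)]
    rw [Finset.sum_add_distrib, Finset.sum_ite_mem, Finset.univ_inter, Finset.sum_const,
      Finset.sum_const, Finset.card_univ, Fintype.card_prod] at h1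
    simp only [nsmul_eq_mul] at h1
    push_cast at h1
    rw [← hn_def] at h1
    have h2 : ε ^ 9 / 64 * n ^ 2 * n ^ 3 ≤ #L * n ^ 3 := by nlinarith [hlow.trans h1]
    exact le_of_mul_le_mul_right h2 (by positivity)
  · intro q hq
    rw [Finset.mem_filter] at hq
    have hq := hq.2
    have hpos : (0 : ℝ) < #{p ∈ good | r p q} :=
      lt_of_lt_of_le (by positivity) hq
    have hpos' : 0 < #{p ∈ good | r p q} := by exact_mod_cast hpos
    obtain ⟨p, hp⟩ := Finset.card_pos.1 hpos'
    have hp := (Finset.mem_filter.1 hp).2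
    have heq : ε ^ 9 / 64 * n ^ 3 = ε ^ 9 / 64 * n ^ 2 * n := by ring
    refine ⟨hp.1.1, hp.2.1, ?_, ?_⟩
    · exact le_of_mul_le_mul_right (heq ▸ hq.trans (hleft q)) hn
    · exact le_of_mul_le_mul_right (heq ▸ hq.trans (hright q)) hn

end SimpleGraph

/-! ### Non-injective colourings are abundant -/

open scoped Classical in
theorem card_not_injective_le {W X : Type*} [Fintype W] [Fintype X]
    (h : Fintype.card W ≤ Fintype.card X) (hX : 0 < Fintype.card X) :
    (#{g : W → X | ¬ Function.Injective g} : ℝ) ≤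
      (Fintype.card W : ℝ) ^ 2 / Fintype.card X * (Fintype.card X : ℝ) ^ Fintype.card W := by
  have h1 : #{g : W → X | Function.Injective g} + #{g : W → X | ¬ Function.Injective g} =
      Fintype.card X ^ Fintype.card W := by
    rw [Finset.card_filter_add_card_filter_not, Finset.card_univ, Fintype.card_fun]
  have h2 : #{g : W → X | Function.Injective g} =
      (Fintype.card X).descFactorial (Fintype.card W) := by
    rw [← Fintype.card_embedding_eq, ← Fintype.card_subtype]
    exact Fintype.card_congr (Equiv.subtypeInjectiveEquivEmbedding W X)
  generalize Fintype.card W = ℓ at *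
  generalize Fintype.card X = n at *
  have h3 : (n - ℓ) ^ ℓ ≤ n.descFactorial ℓ :=
    (Nat.pow_le_pow_left (by omega) ℓ).trans (Nat.pow_sub_le_descFactorial n ℓ)
  have hn : (0 : ℝ) < n := by exact_mod_cast hX
  have h4 : ((n : ℝ) - ℓ) ^ ℓ ≤ n.descFactorial ℓ := by
    rw [← Nat.cast_sub h]
    exact_mod_cast h3
  have h5 : 1 + (ℓ : ℝ) * (-(ℓ / n)) ≤ (1 + -((ℓ : ℝ) / n)) ^ ℓ := by
    refine one_add_mul_le_pow ?_ ℓ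
    have : (ℓ : ℝ) / n ≤ 1 := by
      rw [div_le_one hn]
      exact_mod_cast h
    linarith
  have h6 : (n : ℝ) ^ ℓ * (1 + -((ℓ : ℝ) / n)) ^ ℓ = ((n : ℝ) - ℓ) ^ ℓ := by
    rw [← mul_pow]
    congr 1
    field_simp
    ring
  have h7 := mul_le_mul_of_nonneg_left h5 (pow_nonneg hn.le ℓ)
  rw [h6] at h7
  have h8 : (#{g : W → X | Function.Injective g} : ℝ) + #{g : W → X | ¬ Function.Injective g} =
      (n : ℝ) ^ ℓ := by exact_mod_cast h1
  have h9 : (#{g : W → X | Function.Injective g} : ℝ) = n.descFactorial ℓ := by exact_mod_cast h2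
  have h10 : (n : ℝ) ^ ℓ * (1 + ℓ * (-(ℓ / n))) = (n : ℝ) ^ ℓ - ℓ ^ 2 / n * n ^ ℓ := by ring
  linarith

namespace SimpleGraph

variable {V W X : Type*}

open scoped Classical in
/-- Two closed walks of types `a` and `b` based at the same vertex: the pairs `x, y` joined by many
walks of type `a` and by many walks of type `b` give many homomorphic images of the cycle. -/
theorem IsPacking.le_card_hom [Fintype W] [Fintype X] [Nonempty X] {F : SimpleGraph V}
    {G : SimpleGraph X} {τ : X → V} {𝒟 : Finset (V → X)} (h : IsPacking F G τ 𝒟) {ε : ℝ}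
    (hε : 0 < ε) (hdeg : ∀ x, ε * Fintype.card X ≤ #{f ∈ 𝒟 | f (τ x) = x}) {C : SimpleGraph W}
    {σ : W → V} {s t : ℕ} {v : ℕ → W} (hv : Set.BijOn v (Set.Iio (s + 2 + (t + 2))) Set.univ)
    (hv0 : v (s + 2 + (t + 2)) = v 0) (hσ : σ (v (s + 2)) = σ (v 0))
    (hF : ∀ k < s + 2 + (t + 2), F.Adj (σ (v k)) (σ (v (k + 1))))
    (hC : ∀ w w', C.Adj w w' → ∃ k < s + 2 + (t + 2),
      (w = v k ∧ w' = v (k + 1)) ∨ (w' = v k ∧ w = v (k + 1))) :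
    (ε ^ 9 / 128) ^ (s + t + 3) * (Fintype.card X : ℝ) ^ (s + t + 4) ≤
      #{g : W → X | (∀ w, τ (g w) = σ w) ∧ ∀ w w', C.Adj w w' → G.Adj (g w) (g w')} := by
  have hn : (0 : ℝ) < Fintype.card X := by exact_mod_cast Fintype.card_pos
  set n : ℝ := (Fintype.card X : ℝ) with hn_def
  let a : ℕ → V := fun k => σ (v k)
  let b : ℕ → V := fun k => σ (v (s + 2 + k))
  have ha : ∀ k < s + 2, F.Adj (a k) (a (k + 1)) := fun k hk => hF k (by omega)
  have hb : ∀ k < t + 2, F.Adj (b k) (b (k + 1)) := fun k hk => hF (s + 2 + k) (by omega)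
  have hb0 : b 0 = a 0 := hσ
  have has : a (s + 2) = a 0 := hσ
  have hbt : b (t + 2) = a 0 := congrArg σ hv0
  obtain ⟨L, hL, hprop⟩ := h.exists_many_pairs hε hdeg (ha 0 (by omega))
    (has ▸ (ha (s + 1) (by omega)).symm) (hb0 ▸ hb 0 (by omega))
    (hbt ▸ (hb (t + 1) (by omega)).symm)
  let θ : ℝ := ε ^ 9 / 128 * n
  have hθ : 0 ≤ θ := by positivity
  have hθn : θ * n < ε ^ 9 / 64 * n ^ 2 := by
    have : 0 < ε ^ 9 * n ^ 2 := by positivity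
    simp only [θ]
    nlinarith
  have hwalk₁ : ∀ p : X × X, ∃ S : Finset (ℕ → X), p ∈ L → θ ^ (s + 1) ≤ #S ∧ ∀ Z ∈ S,
      Z 0 = p.1 ∧ (∀ k, s + 2 ≤ k → Z k = p.2) ∧ (∀ k ≤ s + 2, τ (Z k) = a k) ∧
        ∀ k < s + 2, G.Adj (Z k) (Z (k + 1)) := by
    intro p
    by_cases hp : p ∈ L
    · obtain ⟨h1, h2, h3, -⟩ := hprop p hp
      obtain ⟨S, hS⟩ := h.exists_finset_walks hθ ha h1 (h2.trans has.symm) (hθn.trans_le h3)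
      exact ⟨S, fun _ => hS⟩
    · exact ⟨∅, fun h => absurd h hp⟩
  have hwalk₂ : ∀ p : X × X, ∃ S : Finset (ℕ → X), p ∈ L → θ ^ (t + 1) ≤ #S ∧ ∀ Z ∈ S,
      Z 0 = p.2 ∧ (∀ k, t + 2 ≤ k → Z k = p.1) ∧ (∀ k ≤ t + 2, τ (Z k) = b k) ∧
        ∀ k < t + 2, G.Adj (Z k) (Z (k + 1)) := by
    intro p
    by_cases hp : p ∈ L
    · obtain ⟨h1, h2, -, h3⟩ := hprop p hp
      obtain ⟨S, hS⟩ := h.exists_finset_walks hθ hb (h2.trans hb0.symm) (h1.trans hbt.symm)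
        (hθn.trans_le h3)
      exact ⟨S, fun _ => hS⟩
    · exact ⟨∅, fun h => absurd h hp⟩
  choose S₁ hS₁ using hwalk₁
  choose S₂ hS₂ using hwalk₂
  have hidx : ∀ w, ∃ k, k < s + 2 + (t + 2) ∧ v k = w := fun w => by
    obtain ⟨k, hk, hkw⟩ := hv.surjOn (Set.mem_univ w)
    exact ⟨k, hk, hkw⟩
  choose idx hidx_lt hidx using hidx
  -- Follow a walk from `x` to `y` by a walk from `y` back to `x`.
  let H : (ℕ → X) × (ℕ → X) → ℕ → X := fun Z k => if k < s + 2 then Z.1 k else Z.2 (k - (s + 2))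
  let Φ : (Σ _ : X × X, (ℕ → X) × (ℕ → X)) → W → X := fun q w => H q.2 (idx w)
  let dom : Finset (Σ _ : X × X, (ℕ → X) × (ℕ → X)) := L.sigma fun p => S₁ p ×ˢ S₂ p
  have hdom : ∀ q ∈ dom, q.1 ∈ L ∧ q.2.1 ∈ S₁ q.1 ∧ q.2.2 ∈ S₂ q.1 := by
    intro q hq
    simpa [dom, Finset.mem_sigma, Finset.mem_product] using hq
  have hΦ : ∀ q ∈ dom, ∀ k ≤ s + 2 + (t + 2), Φ q (v k) = H q.2 k := by
    intro q hq k hk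
    obtain ⟨hqL, hq1, hq2⟩ := hdom q hq
    have hlt : ∀ k < s + 2 + (t + 2), Φ q (v k) = H q.2 k := fun k hk =>
      congrArg (H q.2) (hv.injOn (hidx_lt (v k)) hk (hidx (v k)))
    rcases hk.lt_or_eq with hk | rfl
    · exact hlt k hk
    · rw [hv0, hlt 0 (by omega)]
      simp only [H, if_pos (Nat.succ_pos (s + 1)), if_neg (show ¬ s + 2 + (t + 2) < s + 2 by omega),
        show s + 2 + (t + 2) - (s + 2) = t + 2 by omega]
      rw [((hS₁ _ hqL).2 _ hq1).1, ((hS₂ _ hqL).2 _ hq2).2.1 _ le_rfl]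
  have hcard : θ ^ (s + 1) * θ ^ (t + 1) * (ε ^ 9 / 64 * n ^ 2) ≤ #dom := by
    rw [Finset.card_sigma]
    push_cast
    calc θ ^ (s + 1) * θ ^ (t + 1) * (ε ^ 9 / 64 * n ^ 2) ≤ θ ^ (s + 1) * θ ^ (t + 1) * #L := by
          gcongr
      _ = ∑ p ∈ L, θ ^ (s + 1) * θ ^ (t + 1) := by
          rw [Finset.sum_const, nsmul_eq_mul, mul_comm]
      _ ≤ _ := Finset.sum_le_sum fun p hp => by
          rw [Finset.card_product]
          push_cast
          exact mul_le_mul (hS₁ p hp).1 (hS₂ p hp).1 (by positivity) (by positivity)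
  have hle : (ε ^ 9 / 128) ^ (s + t + 3) * n ^ (s + t + 4) ≤
      θ ^ (s + 1) * θ ^ (t + 1) * (ε ^ 9 / 64 * n ^ 2) := by
    have h1 : θ ^ (s + 1) * θ ^ (t + 1) * (ε ^ 9 / 64 * n ^ 2) =
        2 * ((ε ^ 9 / 128) ^ (s + t + 3) * n ^ (s + t + 4)) := by
      simp only [θ]
      ring
    have h2 : 0 ≤ (ε ^ 9 / 128) ^ (s + t + 3) * n ^ (s + t + 4) := by positivity
    linarith
  refine (hle.trans hcard).trans ?_
  norm_cast
  refine Finset.card_le_card_of_injOn Φ ?_ ?_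
  · intro q hq
    obtain ⟨hqL, hq1, hq2⟩ := hdom q hq
    obtain ⟨-, p1⟩ := hS₁ _ hqL
    obtain ⟨-, p2⟩ := hS₂ _ hqL
    obtain ⟨x0, xend, xtype, xadj⟩ := p1 _ hq1
    obtain ⟨y0, yend, ytype, yadj⟩ := p2 _ hq2
    simp only [Finset.coe_filter, Finset.mem_univ, true_and, Set.mem_ofPred_eq]
    constructor
    · intro w
      rw [← hidx w, hΦ q hq _ (hidx_lt w).le]
      simp only [H]
      have hlt := hidx_lt w
      split_ifs with hk
      · exact xtype _ (by omega)
      · rw [ytype _ (by omega)]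
        simp only [b]
        congr 2
        omega
    · have hadj : ∀ k < s + 2 + (t + 2), G.Adj (Φ q (v k)) (Φ q (v (k + 1))) := by
        intro k hk
        rw [hΦ q hq _ hk.le, hΦ q hq _ hk]
        simp only [H]
        by_cases hk1 : k + 1 < s + 2
        · rw [if_pos hk1, if_pos (by omega)]
          exact xadj k (by omega)
        · rw [if_neg hk1]
          by_cases hk2 : k < s + 2
          · obtain rfl : k = s + 1 := by omega
            rw [if_pos hk2, Nat.sub_self, y0, ← xend _ le_rfl]
            exact xadj _ hk2
          · rw [if_neg hk2, show k + 1 - (s + 2) = k - (s + 2) + 1 by omega]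
            exact yadj _ (by omega)
      intro w w' hww
      obtain ⟨k, hk, ⟨rfl, rfl⟩ | ⟨rfl, rfl⟩⟩ := hC w w' hww
      exacts [hadj k hk, (hadj k hk).symm]
  · rintro q hq q' hq' heq
    obtain ⟨hqL, hq1, hq2⟩ := hdom q hq
    obtain ⟨hqL', hq1', hq2'⟩ := hdom q' hq'
    obtain ⟨x0, xend, -, -⟩ := (hS₁ _ hqL).2 _ hq1
    obtain ⟨y0, yend, -, -⟩ := (hS₂ _ hqL).2 _ hq2
    obtain ⟨x0', xend', -, -⟩ := (hS₁ _ hqL').2 _ hq1'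
    obtain ⟨y0', yend', -, -⟩ := (hS₂ _ hqL').2 _ hq2'
    have hH : ∀ k ≤ s + 2 + (t + 2), H q.2 k = H q'.2 k := fun k hk => by
      rw [← hΦ q hq k hk, ← hΦ q' hq' k hk, heq]
    have hZ1 : ∀ k < s + 2, q.2.1 k = q'.2.1 k := fun k hk => by
      simpa [H, hk] using hH k (by omega)
    have hZ2 : ∀ k ≤ t + 2, q.2.2 k = q'.2.2 k := fun k hk => by
      simpa [H] using hH (s + 2 + k) (by omega)
    have e1 : q.1.1 = q'.1.1 := by rw [← x0, ← x0', hZ1 0 (by omega)]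
    have e2 : q.1.2 = q'.1.2 := by rw [← y0, ← y0', hZ2 0 (by omega)]
    have e3 : q.2.1 = q'.2.1 := by
      funext k
      rcases lt_or_ge k (s + 2) with hk | hk
      · exact hZ1 k hk
      · rw [xend k hk, xend' k hk, e2]
    have e4 : q.2.2 = q'.2.2 := by
      funext k
      rcases lt_or_ge k (t + 2) with hk | hk
      · exact hZ2 k hk.le
      · rw [yend k hk, yend' k hk, e1]
    obtain ⟨⟨x, y⟩, Z, Z'⟩ := q
    obtain ⟨⟨x', y'⟩, Y, Y'⟩ := q'
    simp only at e1 e2 e3 e4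
    subst e1 e2 e3 e4
    rfl

/-- The maps counted by `IsPacking.le_card_hom` outnumber the non-injective ones, of which there are
only `O(n ^ (|W| - 1))`, once `n` is large in terms of `ε`. -/
theorem isAbundant_of_not_injective [Finite V] {F : SimpleGraph V} {C : SimpleGraph W}
    (hC : C.IsCycleGraph) {σ : C →g F} (hσ : ¬ Function.Injective σ) : IsAbundant F C σ := by
  classical
  simp only [Function.Injective, not_forall] at hσ
  obtain ⟨w₀, w₁, hw, hne⟩ := hσ
  obtain ⟨ℓ, hℓ, v, hv0, hvℓ, hv, hadj⟩ := hC.exists_enum w₀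
  have hF : ∀ k < ℓ, F.Adj (σ (v k)) (σ (v (k + 1))) := fun k hk =>
    σ.map_adj ((hadj _ _).2 ⟨k, hk, Or.inl ⟨rfl, rfl⟩⟩)
  obtain ⟨p, hp, rfl⟩ := hv.surjOn (Set.mem_univ w₁)
  rw [Set.mem_Iio] at hp
  -- Since `F` has no loops, both arcs between the two vertices have length at least two.
  obtain ⟨s, t, rfl, rfl⟩ : ∃ s t, p = s + 2 ∧ ℓ = s + 2 + (t + 2) := by
    have h0 : p ≠ 0 := by
      rintro rfl
      exact hne hv0.symm
    have h1 : p ≠ 1 := by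
      rintro rfl
      have := hF 0 (by omega)
      rw [hv0, hw] at this
      exact this.ne rfl
    have h2 : p + 1 ≠ ℓ := by
      rintro rfl
      have := hF p (by omega)
      rw [hvℓ, hw] at this
      exact this.ne rfl
    exact ⟨p - 2, ℓ - p - 2, by omega, by omega⟩
  have hfin : Finite W := by
    have := hv.finite_iff_finite.1 (Set.finite_Iio _)
    exact Set.finite_univ_iff.1 this
  have := Fintype.ofFinite W
  have hcardW : Fintype.card W = s + t + 4 := by
    have h1 : Set.ncard (v '' Set.Iio (s + 2 + (t + 2))) = s + 2 + (t + 2) := by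
      rw [hv.injOn.ncard_image, ← Finset.coe_Iio, Set.ncard_coe_finset]
      simp
    rw [hv.image_eq, Set.ncard_univ, Nat.card_eq_fintype_card] at h1
    omega
  refine ⟨(1 / 2) * (1 / 128) ^ (s + t + 3), by positivity, 9 * (s + t + 3), fun ε hε => ?_⟩
  set δ : ℝ := (1 / 2) * (ε ^ 9 / 128) ^ (s + t + 3) with hδ
  have hδ0 : 0 < δ := by positivity
  obtain ⟨n₀, hn₀⟩ := exists_nat_ge (((s + t + 4 : ℕ) : ℝ) ^ 2 / δ)
  refine ⟨n₀ + (s + t + 4), fun n hn G τ hG => ?_⟩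
  have hnpos : 0 < n := by omega
  have : Nonempty (Fin n) := ⟨⟨0, hnpos⟩⟩
  have hnR : (0 : ℝ) < n := by exact_mod_cast hnpos
  obtain ⟨𝒟, h𝒟, hdeg⟩ := hG.exists_isPacking
  have hhom := h𝒟.le_card_hom hε hdeg (C := C) (σ := σ) hv (hvℓ.trans hv0.symm)
    (hw.symm.trans (congrArg σ hv0.symm)) hF (fun w w' => (hadj w w').1)
  have hinj := card_not_injective_le (W := W) (X := Fin n) (by rw [hcardW, Fintype.card_fin]; omega)
    (by simpa using hnpos)
  rw [hcardW, Fintype.card_fin] at hinj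
  rw [Fintype.card_fin] at hhom
  have hsmall : ((s + t + 4 : ℕ) : ℝ) ^ 2 / n ≤ δ := by
    have h1 : (n₀ : ℝ) ≤ n := by exact_mod_cast (by omega : n₀ ≤ n)
    have h2 := hn₀.trans h1
    rw [div_le_iff₀ hδ0] at h2
    rw [div_le_iff₀ hnR]
    linarith
  have hcoe : Function.Injective
      fun f : {f : Copy C G // ∀ v, τ (f v) = σ v} => (f.1 : W → Fin n) :=
    fun f g h => Subtype.ext (DFunLike.coe_injective h)
  have hfinC : Finite {f : Copy C G // ∀ v, τ (f v) = σ v} := Finite.of_injective _ hcoe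
  have := Fintype.ofFinite {f : Copy C G // ∀ v, τ (f v) = σ v}
  have hcopies : #{g : W → Fin n | (∀ w, τ (g w) = σ w) ∧
      ∀ w w', C.Adj w w' → G.Adj (g w) (g w')} ≤
      Nat.card {f : Copy C G // ∀ v, τ (f v) = σ v} +
        #{g : W → Fin n | ¬ Function.Injective g} := by
    rw [Nat.card_eq_fintype_card, ← Finset.card_univ,
      ← Finset.card_image_of_injective _ hcoe]
    refine (Finset.card_le_card ?_).trans (Finset.card_union_le _ _)
    intro g hg
    rw [Finset.mem_filter] at hg
    rw [Finset.mem_union, Finset.mem_image, Finset.mem_filter]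
    by_cases hginj : Function.Injective g
    · exact Or.inl ⟨⟨⟨⟨g, fun {w w'} h => hg.2.2 w w' h⟩, hginj⟩, hg.2.1⟩, Finset.mem_univ _, rfl⟩
    · exact Or.inr ⟨Finset.mem_univ _, hginj⟩
  have hcopies' : (#{g : W → Fin n | (∀ w, τ (g w) = σ w) ∧
      ∀ w w', C.Adj w w' → G.Adj (g w) (g w')} : ℝ) ≤
      Nat.card {f : Copy C G // ∀ v, τ (f v) = σ v} +
        #{g : W → Fin n | ¬ Function.Injective g} := by exact_mod_cast hcopies
  have hprod := mul_le_mul_of_nonneg_right hsmall (pow_nonneg hnR.le (s + t + 4))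
  have hpow : (1 / 2 : ℝ) * (1 / 128) ^ (s + t + 3) * ε ^ (9 * (s + t + 3)) = δ := by
    rw [hδ, pow_mul, div_eq_mul_one_div (ε ^ 9), mul_pow]
    ring
  rw [Nat.card_eq_fintype_card (α := W), hcardW, hpow]
  have h2δ : (ε ^ 9 / 128) ^ (s + t + 3) = 2 * δ := by rw [hδ]; ring
  rw [h2δ] at hhom
  -- The two counts of non-injective maps differ in their decidability instances.
  have heq : (#{g : W → Fin n | ¬ Function.Injective g} : ℝ) ≤ δ * n ^ (s + t + 4) := by
    refine le_trans (le_of_eq ?_) (hinj.trans hprod)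
    congr!
  linarith

end SimpleGraph

/-! ### Injective colourings are not abundant -/

/-- On a sphere, a point which is the average of `m` points equals all of them. -/
theorem Behrend.eq_of_sum_eq_nsmul {d r k m : ℕ} {x : ℕ → Fin d → ℕ}
    (hx : ∀ i ≤ m, x i ∈ Behrend.sphere d r k) (hsum : ∑ i ∈ range m, x i = m • x m) :
    ∀ i < m, x i = x m := by
  have hsq : ∀ i ≤ m, ∑ j, (x i j : ℤ) ^ 2 = k := by
    intro i hi
    have := (Finset.mem_filter.1 (hx i hi)).2
    exact_mod_cast this
  have hsum' : ∀ j, ∑ i ∈ range m, (x i j : ℤ) = m * x m j := by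
    intro j
    have := congrFun hsum j
    simp only [Finset.sum_apply, Pi.smul_apply, smul_eq_mul] at this
    exact_mod_cast this
  have key : ∑ i ∈ range m, ∑ j, ((x i j : ℤ) - x m j) ^ 2 = 0 := by
    have h1 : ∀ i ∈ range m, ∑ j, ((x i j : ℤ) - x m j) ^ 2 =
        2 * k - 2 * ∑ j, (x i j : ℤ) * x m j := by
      intro i hi
      have h2 := hsq i (Finset.mem_range.1 hi).le
      have h3 := hsq m le_rfl
      rw [Finset.mul_sum, two_mul]
      nth_rewrite 1 [← h2]
      rw [← h3, ← Finset.sum_add_distrib, ← Finset.sum_sub_distrib]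
      exact Finset.sum_congr rfl fun j _ => by ring
    rw [Finset.sum_congr rfl h1, Finset.sum_sub_distrib, ← Finset.mul_sum, ← Finset.mul_sum,
      Finset.sum_comm]
    simp_rw [← Finset.sum_mul, hsum']
    have h4 : ∑ j, (m : ℤ) * x m j * x m j = m * k := by
      rw [← hsq m le_rfl, Finset.mul_sum]
      exact Finset.sum_congr rfl fun j _ => by ring
    rw [h4]
    simp
  intro i hi
  have h1 := (Finset.sum_eq_zero_iff_of_nonneg fun i _ =>
    Finset.sum_nonneg fun j _ => sq_nonneg _).1 key i (Finset.mem_range.2 hi)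
  funext j
  have h2 := (Finset.sum_eq_zero_iff_of_nonneg fun j _ => sq_nonneg _).1 h1 j (Finset.mem_univ j)
  have h3 : (x i j : ℤ) = x m j := sub_eq_zero.1 (pow_eq_zero_iff two_ne_zero |>.1 h2)
  exact_mod_cast h3

/-- `A` contains no nontrivial solution of the convex equation `x₁ + ⋯ + xₘ = m x`. -/
def AverageFree {Γ : Type*} [AddCommGroup Γ] (m : ℕ) (A : Finset Γ) : Prop :=
  ∀ x : ℕ → Γ, (∀ i ≤ m, x i ∈ A) → ∑ i ∈ range m, x i = m • x m → ∀ i < m, x i = x m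

/-- Behrend's construction without the final projection to the integers: as no carries occur, a
sphere in `{0, …, r - 1} ^ d` remains average-free in `(ℤ / q) ^ d` when `q > m r`. -/
theorem exists_averageFree (m r d q : ℕ) (hrq : r ≤ q) (hmr : m * r < q) :
    ∃ A : Finset (Fin d → ZMod q), AverageFree m A ∧ ((r ^ d : ℕ) / (d * r ^ 2 : ℕ) : ℝ) ≤ #A := by
  classical
  obtain ⟨k, hk⟩ := Behrend.exists_large_sphere d r
  let f : (Fin d → ℕ) → Fin d → ZMod q := fun x j => (x j : ZMod q)
  have hlt : ∀ x ∈ Behrend.sphere d r k, ∀ j, x j < r := fun x hx =>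
    Behrend.mem_box.1 (Behrend.sphere_subset_box hx)
  have hcast : ∀ a b : ℕ, a < q → b < q → (a : ZMod q) = b → a = b := fun a b ha hb h =>
    ((ZMod.natCast_eq_natCast_iff a b q).1 h).eq_of_lt_of_lt ha hb
  refine ⟨(Behrend.sphere d r k).image f, ?_, ?_⟩
  · intro x hx hsum
    have : ∀ i, ∃ y, i ≤ m → y ∈ Behrend.sphere d r k ∧ f y = x i := by
      intro i
      by_cases hi : i ≤ m
      · obtain ⟨y, hy⟩ := Finset.mem_image.1 (hx i hi)
        exact ⟨y, fun _ => hy⟩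
      · exact ⟨0, fun h => absurd h hi⟩
    choose y hy using this
    have hsum' : ∑ i ∈ range m, y i = m • y m := by
      funext j
      rw [Finset.sum_apply, Pi.smul_apply, smul_eq_mul]
      have hle : ∀ i ≤ m, y i j ≤ r := fun i hi => (hlt _ (hy i hi).1 j).le
      refine hcast _ _ ?_ ?_ ?_
      · calc ∑ i ∈ range m, y i j ≤ ∑ _i ∈ range m, r :=
              Finset.sum_le_sum fun i hi => hle i (Finset.mem_range.1 hi).le
          _ = m * r := by simp
          _ < q := hmr
      · exact (Nat.mul_le_mul_left m (hle m le_rfl)).trans_lt hmr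
      · have h1 := congrFun hsum j
        rw [Finset.sum_apply, Pi.smul_apply, nsmul_eq_mul, ← (hy m le_rfl).2] at h1
        push_cast
        rw [← h1]
        refine Finset.sum_congr rfl fun i hi => ?_
        rw [← (hy i (Finset.mem_range.1 hi).le).2]
    intro i hi
    rw [← (hy i hi.le).2, ← (hy m le_rfl).2,
      Behrend.eq_of_sum_eq_nsmul (fun i hi => (hy i hi).1) hsum' i hi]
  · rwa [Finset.card_image_of_injOn]
    intro x hx y hy hxy
    funext j
    exact hcast _ _ ((hlt x hx j).trans_le hrq) ((hlt y hy j).trans_le hrq) (congrFun hxy j)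

namespace SimpleGraph

variable {V W X Γ : Type*} [AddCommGroup Γ]

/-- The graph on `V × Γ`, transported to `X` along `φ`, which is the union of the copies
`i ↦ (i, x + c i • a)` of `F`, where `x` ranges over `Γ` and `a` over `D`. -/
def differenceGraph (F : SimpleGraph V) (c : V → ℤ) (D : Finset Γ) (φ : X ≃ V × Γ) :
    SimpleGraph X where
  Adj p q := F.Adj (φ p).1 (φ q).1 ∧ ∃ a ∈ D, (φ q).2 - (φ p).2 = (c (φ q).1 - c (φ p).1) • a
  symm := ⟨by
    rintro p q ⟨h, a, ha, hpq⟩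
    refine ⟨h.symm, a, ha, ?_⟩
    rw [← neg_sub, hpq, ← neg_smul, neg_sub]⟩
  loopless := ⟨fun p h => h.1.ne rfl⟩

namespace differenceGraph

variable {F : SimpleGraph V} {c : V → ℤ} {D : Finset Γ} {φ : X ≃ V × Γ}

/-- The projection to `F`. -/
def proj (F : SimpleGraph V) (c : V → ℤ) (D : Finset Γ) (φ : X ≃ V × Γ) :
    differenceGraph F c D φ →g F where
  toFun p := (φ p).1
  map_rel' h := h.1

/-- The copy `i ↦ (i, x + c i • a)` of `F`. -/
def copy (F : SimpleGraph V) (c : V → ℤ) (φ : X ≃ V × Γ) (x : Γ) {a : Γ} (ha : a ∈ D) :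
    Copy F (differenceGraph F c D φ) where
  toHom :=
    { toFun := fun i => φ.symm (i, x + c i • a)
      map_rel' := fun {i j} h => by
        refine ⟨by simpa using h, a, ha, ?_⟩
        simp only [Equiv.apply_symm_apply, sub_smul]
        abel }
  injective' i j h := congrArg Prod.fst (φ.symm.injective h)

theorem copy_apply (x : Γ) {a : Γ} (ha : a ∈ D) (i : V) :
    copy F c φ x ha i = φ.symm (i, x + c i • a) := rfl

/-- A copy is determined by any two of its vertices, as long as the differences `c i - c j` act
injectively on `Γ`. -/
theorem eq_of_copy_eq (hc : ∀ i j, i ≠ j → ∀ x : Γ, (c i - c j) • x = 0 → x = 0) {x y a b : Γ}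
    (ha : a ∈ D) (hb : b ∈ D) {i j : V} (hij : i ≠ j)
    (hi : copy F c φ x ha i = copy F c φ y hb i) (hj : copy F c φ x ha j = copy F c φ y hb j) :
    x = y ∧ a = b := by
  have hi' : x + c i • a = y + c i • b := congrArg Prod.snd (φ.symm.injective hi)
  have hj' : x + c j • a = y + c j • b := congrArg Prod.snd (φ.symm.injective hj)
  have hab : a = b := by
    refine sub_eq_zero.1 (hc i j hij _ ?_)
    calc (c i - c j) • (a - b) = (x + c i • a - (x + c j • a)) - (y + c i • b - (y + c j • b)) := by
          rw [sub_smul, smul_sub, smul_sub]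
          abel
      _ = 0 := by rw [hi', hj', sub_self]
  subst hab
  exact ⟨add_right_cancel hi', rfl⟩

/-- The copies `copy F c φ x ha` are edge-disjoint, and each vertex lies in exactly one of them for
every `a ∈ D`. -/
theorem isUniformlyFarFromFree [Finite V] [Finite X]
    (hc : ∀ i j, i ≠ j → ∀ x : Γ, (c i - c j) • x = 0 → x = 0) {i₀ j₀ : V} (h₀ : i₀ ≠ j₀) {ε : ℝ}
    (hε : ε * Nat.card X ≤ #D) :
    IsUniformlyFarFromFree F (differenceGraph F c D φ) (proj F c D φ) ε := by
  refine ⟨{f | ∃ x a, ∃ ha : a ∈ D, copy F c φ x ha = f}, ?_, ?_, ?_⟩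
  · rintro _ ⟨x, a, ha, rfl⟩ i
    simp [proj, copy_apply]
  · rintro _ ⟨x, a, ha, rfl⟩ _ ⟨y, b, hb, rfl⟩ hne
    refine Set.disjoint_left.2 ?_
    rintro _ ⟨e, he, rfl⟩ ⟨e', -, heq⟩
    induction e with | _ i j
    induction e' with | _ i' j'
    have hij : i ≠ j := Adj.ne he
    have hfst : ∀ k k', copy F c φ y hb k = copy F c φ x ha k' → k = k' := fun k k' h =>
      congrArg Prod.fst (φ.symm.injective h)
    have hdet : copy F c φ y hb i = copy F c φ x ha i → copy F c φ y hb j = copy F c φ x ha j →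
        False := fun h1 h2 => by
      obtain ⟨rfl, rfl⟩ := eq_of_copy_eq hc hb ha hij h1 h2
      exact hne rfl
    simp only [Sym2.map_mk, Sym2.eq_iff] at heq
    rcases heq with ⟨h1, h2⟩ | ⟨h1, h2⟩
    · obtain rfl := hfst _ _ h1
      obtain rfl := hfst _ _ h2
      exact hdet h1 h2
    · obtain rfl := hfst _ _ h1
      obtain rfl := hfst _ _ h2
      exact hdet h2 h1
  · intro p
    have hfin : Finite (Copy F (differenceGraph F c D φ)) :=
      Finite.of_injective (fun f => (f : V → X)) DFunLike.coe_injective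
    refine hε.trans ?_
    rw [Nat.cast_le, ← Nat.card_eq_finsetCard, ← Nat.card_coe_set_eq]
    refine Nat.card_le_card_of_injective (fun a => ⟨copy F c φ ((φ p).2 - c (φ p).1 • a.1) a.2,
      ⟨_, _, a.2, rfl⟩, (φ p).1, ?_⟩) ?_
    · rw [copy_apply, sub_add_cancel]
      exact φ.symm_apply_apply p
    · intro a b hab
      have h := Subtype.ext_iff.1 hab
      exact Subtype.ext (eq_of_copy_eq hc a.2 b.2 h₀ (congrArg (fun f => f i₀) h)
        (congrArg (fun f => f j₀) h)).2

variable {Γ₁ Γ₂ : Type*} [AddCommGroup Γ₁] [AddCommGroup Γ₂]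

/-- If `c` increases by one along each edge of the cycle but the last, then the differences along a
copy of the cycle solve `x₁ + ⋯ + xₘ = m x`. When the differences come from an average-free set,
the vertices of the copy form an arithmetic progression, determined by its first two terms. -/
theorem card_copies_le [Finite Γ₁] [Finite Γ₂] [Fintype W] {C : SimpleGraph W} {σ : C →g F} {m : ℕ}
    (hm : 2 ≤ m) {v : ℕ → W} (hv : ∀ w, ∃ k ≤ m, v k = w) (hv0 : v (m + 1) = v 0)
    (hadj : ∀ k ≤ m, C.Adj (v k) (v (k + 1))) (hc : ∀ k ≤ m, c (σ (v k)) = k) {A : Finset Γ₁}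
    (hA : AverageFree m A) {D : Finset (Γ₁ × Γ₂)} (hD : ∀ a ∈ D, a.1 ∈ A)
    (φ : X ≃ V × (Γ₁ × Γ₂)) :
    Nat.card {f : Copy C (differenceGraph F c D φ) // ∀ w, proj F c D φ (f w) = σ w} ≤
      Nat.card Γ₁ ^ 2 * Nat.card Γ₂ ^ Fintype.card W := by
  let pos : {f : Copy C (differenceGraph F c D φ) // ∀ w, proj F c D φ (f w) = σ w} → W → Γ₁ × Γ₂ :=
    fun f w => (φ (f.1 w)).2
  have hprog : ∀ f, ∀ k ≤ m, (pos f (v k)).1 =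
      (pos f (v 0)).1 + k • ((pos f (v 1)).1 - (pos f (v 0)).1) := by
    intro f
    have hedge : ∀ k, ∃ a : Γ₁, k ≤ m → a ∈ A ∧ (pos f (v (k + 1))).1 - (pos f (v k)).1 =
        (c (σ (v (k + 1))) - c (σ (v k))) • a := by
      intro k
      by_cases hk : k ≤ m
      · obtain ⟨-, a, ha, h⟩ := f.1.toHom.map_adj (hadj k hk)
        refine ⟨a.1, fun _ => ⟨hD a ha, ?_⟩⟩
        have e1 : (φ (f.1 (v (k + 1)))).1 = σ (v (k + 1)) := f.2 _
        have e2 : (φ (f.1 (v k))).1 = σ (v k) := f.2 _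
        rw [← e1, ← e2]
        exact congrArg Prod.fst h
      · exact ⟨0, fun h => absurd h hk⟩
    choose a ha using hedge
    have hstep : ∀ k < m, (pos f (v (k + 1))).1 - (pos f (v k)).1 = a k := by
      intro k hk
      rw [(ha k hk.le).2, hc (k + 1) hk, hc k hk.le]
      simp
    have hclose : (pos f (v 0)).1 - (pos f (v m)).1 = -(m • a m) := by
      have h := (ha m le_rfl).2
      rw [hv0, hc m le_rfl, hc 0 (by omega)] at h
      simpa using h
    have hsum : ∑ k ∈ range m, a k = m • a m := by
      rw [← Finset.sum_congr rfl fun k hk => hstep k (Finset.mem_range.1 hk),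
        Finset.sum_range_sub fun k => (pos f (v k)).1, ← neg_sub, hclose, neg_neg]
    have hconst := hA a (fun k hk => (ha k hk).1) hsum
    intro k
    induction k with
    | zero => simp
    | succ k ih =>
      intro hk
      have h1 : (pos f (v (k + 1))).1 - (pos f (v k)).1 = (pos f (v 1)).1 - (pos f (v 0)).1 := by
        rw [hstep k hk, hconst k hk, ← hconst 0 (by omega)]
        exact (hstep 0 (by omega)).symm
      rw [succ_nsmul, ← add_assoc, ← ih (by omega), ← h1, add_sub_cancel]
  have hinj : Function.Injective fun f =>
      (((pos f (v 0)).1, (pos f (v 1)).1), fun w => (pos f w).2) := by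
    intro f g hfg
    simp only [Prod.mk.injEq] at hfg
    obtain ⟨⟨h0, h1⟩, h2⟩ := hfg
    have hpos : ∀ w, pos f w = pos g w := by
      intro w
      refine Prod.ext ?_ (congrFun h2 w)
      obtain ⟨k, hk, rfl⟩ := hv w
      rw [hprog f k hk, hprog g k hk, h0, h1]
    refine Subtype.ext (DFunLike.coe_injective (funext fun w => φ.injective (Prod.ext ?_ (hpos w))))
    exact (f.2 w).trans (g.2 w).symm
  refine (Nat.card_le_card_of_injective _ hinj).trans (le_of_eq ?_)
  rw [Nat.card_prod, Nat.card_prod, Nat.card_fun, sq, Nat.card_eq_fintype_card (α := W)]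

end differenceGraph

theorem not_isAbundant_of_injective [Finite V] {F : SimpleGraph V} {C : SimpleGraph W}
    (hC : C.IsCycleGraph) {σ : C →g F} (hσ : Function.Injective σ) : ¬ IsAbundant F C σ := by
  classical
  have := Fintype.ofFinite V
  have hfin : Finite W := Finite.of_injective σ hσ
  have := Fintype.ofFinite W
  have hW : Nonempty W := by
    obtain ⟨ℓ, hℓ, ⟨e⟩⟩ := hC
    exact ⟨e ⟨0, by omega⟩⟩
  obtain ⟨ℓ, hℓ, v, hv0, hvℓ, hv, hadj⟩ := hC.exists_enum hW.some
  obtain ⟨m, rfl⟩ : ∃ m, ℓ = m + 1 := ⟨ℓ - 1, by omega⟩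
  have hm : 2 ≤ m := by omega
  have hadj' : ∀ k ≤ m, C.Adj (v k) (v (k + 1)) := fun k hk =>
    (hadj _ _).2 ⟨k, by omega, Or.inl ⟨rfl, rfl⟩⟩
  have hsurj : ∀ w, ∃ k ≤ m, v k = w := fun w => by
    obtain ⟨k, hk, rfl⟩ := hv.surjOn (Set.mem_univ w)
    exact ⟨k, Nat.lt_succ_iff.1 hk, rfl⟩
  have hvinj : Function.Injective fun k : Fin (m + 1) => v k := fun a b h =>
    Fin.ext (hv.injOn a.2 b.2 h)
  have hcardW : 3 ≤ Fintype.card W := by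
    have := Fintype.card_le_of_injective _ hvinj
    rw [Fintype.card_fin] at this
    omega
  obtain ⟨num, hnum_inj, hnum, hnum_lt⟩ := exists_numbering (hσ.comp hvinj)
  set M : ℕ := m + 1 + Fintype.card V with hM
  let c : V → ℤ := fun i => num i
  have hc : ∀ k ≤ m, c (σ (v k)) = k := fun k hk => by
    have := hnum ⟨k, by omega⟩
    simp only [Function.comp_apply] at this
    simp only [c, this]
  have hVpos : 0 < Fintype.card V := Fintype.card_pos_iff.2 ⟨σ (v 0)⟩
  rintro ⟨γ, hγ, K, habund⟩
  -- A sphere in dimension `2 K + 1` has density of order `r ^ (-2)` in a group of order at least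
  -- `r ^ (2 K + 1)`, and this beats the `K`-th power in the definition of abundance.
  set d : ℕ := 2 * K + 1 with hd
  obtain ⟨κ, hκ⟩ : ∃ κ : ℝ, κ = 1 / (Fintype.card V * d * (2 * M) ^ d) := ⟨_, rfl⟩
  have hκ0 : 0 < κ := by
    rw [hκ]
    have : (0 : ℝ) < Fintype.card V := by exact_mod_cast hVpos
    have : (0 : ℝ) < d := by exact_mod_cast Nat.succ_pos _
    have : (0 : ℝ) < M := by exact_mod_cast (by omega : 0 < M)
    positivity
  obtain ⟨r, hr⟩ := exists_nat_gt (1 / (γ * κ ^ K))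
  have hr0 : (0 : ℝ) < r := (by positivity : (0 : ℝ) < 1 / (γ * κ ^ K)).trans hr
  have hr0' : 0 < r := by exact_mod_cast hr0
  obtain ⟨q, hqp, hMq, hqM⟩ := Nat.exists_prime_lt_and_le_two_mul (M * r)
    (Nat.mul_pos (by omega) hr0').ne'
  have : Fact q.Prime := ⟨hqp⟩
  have hMr : M ≤ M * r := Nat.le_mul_of_pos_right M hr0'
  have hrM : r ≤ M * r := Nat.le_mul_of_pos_left r (by omega)
  obtain ⟨A, hA, hAcard⟩ := exists_averageFree m r d q (by omega)
    ((Nat.mul_le_mul_right r (by omega : m ≤ M)).trans_lt hMq)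
  set N : ℝ := (q : ℝ) ^ d with hN
  have hq0 : (0 : ℝ) < q := by exact_mod_cast hqp.pos
  have hN0 : 0 < N := by positivity
  have hV0 : (0 : ℝ) < Fintype.card V := by exact_mod_cast hVpos
  have hd0 : (0 : ℝ) < d := by exact_mod_cast Nat.succ_pos _
  have hM0 : (0 : ℝ) < M := by exact_mod_cast (by omega : 0 < M)
  set ε : ℝ := #A / (Fintype.card V * N) with hε
  have hεlow : κ / r ^ 2 ≤ ε := by
    have h1 : N ≤ (2 * M) ^ d * r ^ d := by
      rw [hN, ← mul_pow]
      refine pow_le_pow_left₀ hq0.le ?_ d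
      have : (q : ℝ) ≤ 2 * (M * r) := by exact_mod_cast hqM
      linarith
    rw [hε, le_div_iff₀ (by positivity)]
    refine le_trans ?_ hAcard
    calc κ / r ^ 2 * (Fintype.card V * N)
        ≤ κ / r ^ 2 * (Fintype.card V * ((2 * M) ^ d * r ^ d)) := by gcongr
      _ = ((r ^ d : ℕ) / (d * r ^ 2 : ℕ) : ℝ) := by
        rw [hκ]
        push_cast
        field_simp
  have hε0 : 0 < ε := (by positivity : 0 < κ / r ^ 2).trans_le hεlow
  obtain ⟨n₀, hn₀⟩ := habund ε hε0
  obtain ⟨b, hb, hbp⟩ := Nat.exists_infinite_primes (n₀ + M)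
  have : Fact b.Prime := ⟨hbp⟩
  let D : Finset ((Fin d → ZMod q) × ZMod b) := A ×ˢ Finset.univ
  have hcardΓ : Fintype.card (V × ((Fin d → ZMod q) × ZMod b)) =
      Fintype.card V * (q ^ d * b) := by
    simp [Fintype.card_prod, ZMod.card]
  set n : ℕ := Fintype.card V * (q ^ d * b) with hn
  let φ : Fin n ≃ V × ((Fin d → ZMod q) × ZMod b) := (Fintype.equivFinOfCardEq hcardΓ).symm
  have hb0 : (0 : ℝ) < b := by exact_mod_cast hbp.pos
  have hnR : (n : ℝ) = Fintype.card V * (N * b) := by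
    rw [hn, hN]
    push_cast
    rfl
  have hdiff : ∀ p : ℕ, p.Prime → M ≤ p → ∀ i j, i ≠ j → ((c i - c j : ℤ) : ZMod p) ≠ 0 := by
    intro p hp hMp i j hij h
    rw [ZMod.intCast_zmod_eq_zero_iff_dvd] at h
    have h1 := hnum_lt i
    have h2 := hnum_lt j
    have h3 : c i - c j = 0 := by
      refine Int.eq_zero_of_abs_lt_dvd h ?_
      rw [abs_lt]
      simp only [c]
      constructor <;> omega
    simp only [c] at h3
    exact hij (hnum_inj (by omega))
  have hact : ∀ i j, i ≠ j → ∀ x : (Fin d → ZMod q) × ZMod b, (c i - c j) • x = 0 → x = 0 := by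
    rintro i j hij ⟨x, y⟩ h
    rw [Prod.smul_mk, Prod.mk_eq_zero] at h
    refine Prod.ext (funext fun k => ?_) ?_
    · have h1 := congrFun h.1 k
      rw [Pi.smul_apply, zsmul_eq_mul] at h1
      exact (mul_eq_zero.1 h1).resolve_left (hdiff q hqp (by omega) i j hij)
    · have h1 := h.2
      rw [zsmul_eq_mul] at h1
      exact (mul_eq_zero.1 h1).resolve_left (hdiff b hbp (by omega) i j hij)
  have hfar : IsUniformlyFarFromFree F (differenceGraph F c D φ)
      (differenceGraph.proj F c D φ) ε := by
    refine differenceGraph.isUniformlyFarFromFree hact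
      (σ.map_adj (hadj' 0 (by omega))).ne (le_of_eq ?_)
    rw [Nat.card_eq_fintype_card, Fintype.card_fin, hnR, hε, Finset.card_product, Finset.card_univ,
      ZMod.card]
    push_cast
    field_simp
  have hbn : n₀ ≤ n := by
    have h1 : b ≤ n := by
      rw [hn, ← mul_assoc]
      exact Nat.le_mul_of_pos_left b (Nat.mul_pos hVpos (pow_pos hqp.pos d))
    omega
  have hlow := hn₀ n hbn _ _ hfar
  have hup := differenceGraph.card_copies_le (F := F) (σ := σ) hm hsurj (hvℓ.trans hv0.symm) hadj'
    hc hA (D := D) (fun a ha => (Finset.mem_product.1 ha).1) φ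
  have hup' : (Nat.card {f : Copy C (differenceGraph F c D φ) //
      ∀ w, differenceGraph.proj F c D φ (f w) = σ w} : ℝ) ≤ N ^ 2 * b ^ Fintype.card W := by
    refine (Nat.cast_le.2 hup).trans (le_of_eq ?_)
    rw [Nat.card_eq_fintype_card, Nat.card_eq_fintype_card, ZMod.card, Fintype.card_fun, ZMod.card,
      Fintype.card_fin, hN]
    push_cast
    rfl
  have hcomb := hlow.trans hup'
  rw [Nat.card_eq_fintype_card, hnR, ← mul_assoc, mul_pow, ← mul_assoc] at hcomb
  have h1 := le_of_mul_le_mul_right hcomb (pow_pos hb0 _)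
  have hN1 : 1 ≤ N := one_le_pow₀ (by exact_mod_cast hqp.one_le)
  have hV1 : (1 : ℝ) ≤ Fintype.card V := by exact_mod_cast hVpos
  have h2 : N ^ 3 ≤ (Fintype.card V * N) ^ Fintype.card W := by
    calc N ^ 3 ≤ (Fintype.card V * N) ^ 3 := by
          gcongr
          exact le_mul_of_one_le_left hN0.le hV1
      _ ≤ _ := pow_le_pow_right₀ (one_le_mul_of_one_le_of_one_le hV1 hN1) hcardW
  have h3 : γ * ε ^ K * N * N ^ 2 ≤ 1 * N ^ 2 := by
    calc γ * ε ^ K * N * N ^ 2 = γ * ε ^ K * N ^ 3 := by ring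
      _ ≤ γ * ε ^ K * (Fintype.card V * N) ^ Fintype.card W := by gcongr
      _ ≤ N ^ 2 := h1
      _ = 1 * N ^ 2 := (one_mul _).symm
  have h4 := le_of_mul_le_mul_right h3 (by positivity)
  have hrq : (r : ℝ) ≤ q := by exact_mod_cast (by omega : r ≤ q)
  have h5 : γ * κ ^ K * r ≤ 1 := by
    refine le_trans ?_ h4
    calc γ * κ ^ K * r = γ * (κ / r ^ 2) ^ K * r ^ d := by
          rw [hd, div_pow, ← pow_mul, pow_succ (r : ℝ) (2 * K)]
          field_simp
      _ ≤ γ * ε ^ K * N := by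
          rw [hN]
          gcongr
  rw [div_lt_iff₀ (by positivity)] at hr
  linarith

end SimpleGraph

/-! ### The equivalence -/

theorem mainTheorem7 {V W : Type*} [Finite V] (F : SimpleGraph V) (C : SimpleGraph W)
    (hC : C.IsCycleGraph) (σ : C →g F) :
    List.TFAE [
      SimpleGraph.IsAbundant F C σ,
      ∀ E ∈ SimpleGraph.allCycleEquations σ, ¬ E.IsConvex,
      ∀ E ∈ SimpleGraph.allCycleEquations σ, 2 ≤ E.genus] := by
  have not_injective_of : (∀ E ∈ SimpleGraph.allCycleEquations σ, ¬ E.IsConvex) →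
      ¬ Function.Injective σ := fun h hσ => by
    obtain ⟨E, hE, hconv⟩ := SimpleGraph.exists_isConvex_of_injective hC hσ
    exact h E hE hconv
  tfae_have 1 → 3 := by
    intro h E hE
    simp only [SimpleGraph.allCycleEquations, Set.mem_iUnion] at hE
    obtain ⟨n, c, z, rfl⟩ := hE
    exact SimpleGraph.two_le_genus_cycleEquation hC
      (fun hσ => SimpleGraph.not_isAbundant_of_injective hC hσ h) c z
  tfae_have 3 → 2 := fun h E hE =>
    TranslationInvariantEquation.not_isConvex_of_two_le_genus (h E hE)
  tfae_have 2 → 1 := fun h => SimpleGraph.isAbundant_of_not_injective hC (not_injective_of h)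
  tfae_finish
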